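/- Let $\mathbb K$ be $\mathbb R$ or $\mathbb C$, the scalar field of all Banach spaces below. For Banach spaces $E, X$ let $\mathscr B(X)$ denote the Banach algebra of all bounded linear operators on $X$ with the operator norm, and let $$\mathscr S_E(X)=\{T\in\mathscr B(X)\colon T \text{ is not bounded below on any copy of } E\}.$$ Here $T\in\mathscr B(X)$ is called bounded below on a copy of $E$ if there are a subspace $E_0\subseteq X$ that is linearly homeomorphic to $E$ and a constant $c>0$ such that $\|Tx\|\geqslant c\|x\|$ for all $x\in E_0$. For a cardinal number $\kappa$, viewed as a set of cardinality $\kappa$, let $c_0(\kappa)$ be the space of all functions $f\colon\kappa\to\mathbb K$ such that $\{\alpha\in\kappa\colon |f(\alpha)|\geqslant\varepsilon\}$ is finite for every $\varepsilon>0$, with the supremum norm, and, for $p\in[1,\infty)$, let $\ell_p(\kappa)$ be the space of all functions $f\colon\kappa\to\mathbb K$ with $\|f\|=\big(\sum_{\alpha\in\kappa}|f(\alpha)|^p\big)^{1/p}<\infty$. **Theorem 1.5.** Let $\lambda$ be an infinite cardinal number and let $p\in[1,\infty)$. 1. For every non-zero, proper, closed two-sided ideal $\mathscr J$ of $\mathscr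 B(c_0(\lambda))$ there is an infinite cardinal number $\kappa\leqslant\lambda$ such that $\mathscr J=\mathscr S_{c_0(\kappa)}(c_0(\lambda))$. 2. For every non-zero, proper, closed two-sided ideal $\mathscr J$ of $\mathscr B(\ell_p(\lambda))$ there is an infinite cardinal number $\kappa\leqslant\lambda$ such that $\mathscr J=\mathscr S_{\ell_p(\kappa)}(\ell_p(\lambda))$. -/

import Mathlib

open scoped ZeroAtInfty ENNReal Cardinal

universe u

/-- The set `Γ` regarded as a discrete topological space. -/
def DiscreteSpace (Γ : Type u) : Type u := Γ

instance (Γ : Type u) : TopologicalSpace (DiscreteSpace Γ) := ⊥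

instance (Γ : Type u) : DiscreteTopology (DiscreteSpace Γ) := ⟨rfl⟩

/-- `c₀(κ)` over `𝕜`: the functions `κ → 𝕜` that tend to zero along the cofinite filter, with the
supremum norm. The cardinal `κ` is represented by its chosen set `κ.out` of cardinality `κ`. -/
abbrev SmallC0 (𝕜 : Type*) [RCLike 𝕜] (κ : Cardinal.{u}) : Type _ :=
  C₀(DiscreteSpace κ.out, 𝕜)

/-- `ℓ_p(κ)` over `𝕜`: the `p`-summable functions `κ → 𝕜`, with the `ℓ_p`-norm. -/
abbrev SmallLp (𝕜 : Type*) [RCLike 𝕜] (p : ℝ≥0∞) (κ : Cardinal.{u}) : Type _ :=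
  lp (fun _ : κ.out => 𝕜) p

section Singular

variable {𝕜 : Type*} [RCLike 𝕜]
  (E : Type*) [NormedAddCommGroup E] [NormedSpace 𝕜 E]
  {X : Type*} [NormedAddCommGroup X] [NormedSpace 𝕜 X]
  {Y : Type*} [NormedAddCommGroup Y] [NormedSpace 𝕜 Y]

/-- `T` is bounded below on a copy of `E`: there are a subspace `E₀` of the domain that is
(linearly and topologically) isomorphic to `E`, and a constant `c > 0`, such that
`c ‖x‖ ≤ ‖T x‖` for all `x ∈ E₀`. -/
def BoundedBelowOnCopy (T : X →L[𝕜] Y) : Prop :=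
  ∃ E₀ : Submodule 𝕜 X, Nonempty (E₀ ≃L[𝕜] E) ∧
    ∃ c : ℝ, 0 < c ∧ ∀ x ∈ E₀, c * ‖x‖ ≤ ‖T x‖

variable (𝕜 X Y) in
/-- The set `𝒮_E(X, Y)` of `E`-singular operators from `X` to `Y`. -/
def singularOperators : Set (X →L[𝕜] Y) :=
  {T | ¬ BoundedBelowOnCopy E T}

end Singular

-- Both parts follow from one dichotomy, valid for an axiomatised family `X Γ` covering `c₀` and
-- `ℓ_p`. For infinite `I`, an operator `S` either is a norm limit of operators factoring through
-- spaces `X K` with `#K < #I`, or the identity of `X I` factors through `S`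
-- (`approxBySmaller_or_idFactorsThrough`).
--
-- Let `κ` be the least infinite cardinal for which `J` contains no `U ∘L V` with `V ∘L U` the
-- identity of `X κ`; since `J` is proper, `κ ≤ lam`. If `T ∈ J` is bounded below on a copy of `X
-- κ`, a density count excludes approximability of `T` restricted to the copy, so the identity of `X
-- κ` factors through `T`, contradicting the choice of `κ`. If `T` is `X κ`-singular, it is a limit
-- of operators through smaller `X K`. These lie in `J`, by minimality of `κ` for infinite `K` and
-- by finite rank for finite `K`, and `J` is closed.
--
-- The dichotomy is a transfinite gliding hump. If `S` is not approximable, recursion along a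
-- shortest well-order of `I` gives vectors of norm at most one with large images, each nearly
-- supported off the essential supports of the earlier images. So `S` is block diagonal up to an
-- error that a Neumann series absorbs. For `c₀` and `ℓ_p` with `p > 1`, functionals are almost
-- finitely supported, so few output coordinates are controlled by discarding few input coordinates.
-- This fails for `ℓ₁`; there additivity of the norm confines the images, and any bounded family can
-- serve as the images of the unit vectors.

universe v w

/-- A family `X` of Banach spaces of scalar functions, indexed by all sets `Γ`, whose
norm is solid, for which the finitely supported functions are dense, and for which disjoint blocks
behave like the unit vectors. Both `c₀` and `ℓ_p`, for `p < ∞`, are of this kind. -/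
class SequenceSpace (𝕜 : Type w) [RCLike 𝕜] (X : Type u → Type v)
    [∀ Γ, NormedAddCommGroup (X Γ)] [∀ Γ, NormedSpace 𝕜 (X Γ)] where
  /-- The coordinates of a vector. -/
  coord : ∀ {Γ : Type u}, X Γ →ₗ[𝕜] (Γ → 𝕜)
  coord_injective : ∀ {Γ : Type u}, Function.Injective (coord : X Γ → Γ → 𝕜)
  norm_coord_le : ∀ {Γ : Type u} (x : X Γ) (i : Γ), ‖coord x i‖ ≤ ‖x‖
  exists_single : ∀ {Γ : Type u} (i : Γ),
    ∃ x : X Γ, coord x = Set.indicator {i} (fun _ => (1 : 𝕜)) ∧ ‖x‖ ≤ 1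
  solid : ∀ {Γ : Type u} (x : X Γ) (f : Γ → 𝕜), (∀ i, ‖f i‖ ≤ ‖coord x i‖) →
    ∃ y : X Γ, coord y = f ∧ ‖y‖ ≤ ‖x‖
  approx : ∀ {Γ : Type u} (x : X Γ) (ε : ℝ), 0 < ε → ∃ F : Finset Γ, ∀ y : X Γ,
    coord y = Set.indicator (F : Set Γ)ᶜ (coord x) → ‖y‖ ≤ ε
  -- The numbers `f i` stand for values of functionals of norm at most one on the blocks `y i`; this
  -- makes block-wise functionals into a bounded operator.
  analysis : ∀ {Γ I : Type u} (B : I → Set Γ), Pairwise (fun i j => Disjoint (B i) (B j)) →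
    ∀ (x : X Γ) (y : I → X Γ) (f : I → 𝕜), (∀ i, coord (y i) = (B i).indicator (coord x)) →
      (∀ i, ‖f i‖ ≤ ‖y i‖) → ∃ z : X I, coord z = f ∧ ‖z‖ ≤ ‖x‖
  synthesis : ∀ {Γ I : Type u} (x : I → X Γ),
    (∀ i j γ, coord (x i) γ ≠ 0 → coord (x j) γ ≠ 0 → i = j) → (∀ i, ‖x i‖ ≤ 1) →
    ∀ a : X I, ∃ z : X Γ, (∀ i γ, coord (x i) γ ≠ 0 → coord z γ = coord a i * coord (x i) γ) ∧
      (∀ γ, (∀ i, coord (x i) γ = 0) → coord z γ = 0) ∧ ‖z‖ ≤ ‖a‖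

/-! ### Band projections, unit vectors and block operators -/

namespace SequenceSpace

variable {𝕜 : Type w} [RCLike 𝕜] {X : Type u → Type v}
  [∀ Γ, NormedAddCommGroup (X Γ)] [∀ Γ, NormedSpace 𝕜 (X Γ)] [SequenceSpace 𝕜 X]
  {Γ Λ I K : Type u}

theorem ext_coord {x y : X Γ} (h : ∀ i, coord (𝕜 := 𝕜) x i = coord y i) : x = y :=
  coord_injective (𝕜 := 𝕜) (funext h)

variable (𝕜) in
/-- The band projection onto the vectors supported by `B`. -/
noncomputable def proj (B : Set Γ) : X Γ →L[𝕜] X Γ :=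
  have h : ∀ x : X Γ, ∃ y : X Γ, coord (𝕜 := 𝕜) y = B.indicator (coord x) ∧ ‖y‖ ≤ ‖x‖ := fun x =>
    solid x _ fun _ => norm_indicator_le_norm_self _ _
  LinearMap.mkContinuous
    { toFun := fun x => (h x).choose
      map_add' := fun x y => coord_injective (𝕜 := 𝕜) <| by
        rw [(h _).choose_spec.1, map_add, map_add, (h _).choose_spec.1, (h _).choose_spec.1,
          Set.indicator_add']
      map_smul' := fun c x => coord_injective (𝕜 := 𝕜) <| by
        rw [(h _).choose_spec.1, RingHom.id_apply, map_smul, map_smul, (h _).choose_spec.1]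
        exact Set.indicator_const_smul B c (coord x) } 1
    fun x => by simpa using (h x).choose_spec.2

theorem coord_proj (B : Set Γ) (x : X Γ) :
    coord (𝕜 := 𝕜) (proj 𝕜 B x) = B.indicator (coord x) :=
  (solid x _ fun _ => norm_indicator_le_norm_self (s := B) _ _ :
    ∃ y : X Γ, coord (𝕜 := 𝕜) y = B.indicator (coord x) ∧ ‖y‖ ≤ ‖x‖).choose_spec.1

theorem norm_proj_apply_le (B : Set Γ) (x : X Γ) : ‖proj 𝕜 B x‖ ≤ ‖x‖ :=
  (solid x _ fun _ => norm_indicator_le_norm_self (s := B) _ _ :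
    ∃ y : X Γ, coord (𝕜 := 𝕜) y = B.indicator (coord x) ∧ ‖y‖ ≤ ‖x‖).choose_spec.2

theorem proj_proj (A B : Set Γ) (x : X Γ) : proj 𝕜 A (proj 𝕜 B x) = proj 𝕜 (A ∩ B) x :=
  coord_injective (𝕜 := 𝕜) <| by simp only [coord_proj, Set.indicator_indicator]

theorem norm_proj_mono {A B : Set Γ} (h : A ⊆ B) (x : X Γ) : ‖proj 𝕜 A x‖ ≤ ‖proj 𝕜 B x‖ := by
  rw [← Set.inter_eq_left.2 h, ← proj_proj]
  exact norm_proj_apply_le _ _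

theorem proj_add_proj_compl (A : Set Γ) (x : X Γ) : proj 𝕜 A x + proj 𝕜 Aᶜ x = x :=
  coord_injective (𝕜 := 𝕜) <| by
    simp only [coord_proj, map_add]
    exact Set.indicator_self_add_compl _ _

theorem sub_proj (A : Set Γ) (x : X Γ) : x - proj 𝕜 A x = proj 𝕜 Aᶜ x := by
  rw [sub_eq_iff_eq_add', proj_add_proj_compl]

theorem norm_proj_union_le (A B : Set Γ) (x : X Γ) :
    ‖proj 𝕜 (A ∪ B) x‖ ≤ ‖proj 𝕜 A x‖ + ‖proj 𝕜 B x‖ := by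
  have h := proj_add_proj_compl (𝕜 := 𝕜) A (proj 𝕜 (A ∪ B) x)
  rw [← h, proj_proj, proj_proj]
  exact (norm_add_le _ _).trans (add_le_add (norm_proj_mono (by simp) x)
    (norm_proj_mono (by intro a; simp; tauto) x))

theorem proj_eq_self {A : Set Γ} {x : X Γ} (h : ∀ γ ∉ A, coord (𝕜 := 𝕜) x γ = 0) :
    proj 𝕜 A x = x :=
  coord_injective (𝕜 := 𝕜) <| by
    rw [coord_proj]
    exact Set.indicator_eq_self.2 fun γ hγ => by_contra fun h' => hγ (h γ h')

theorem exists_finset_norm_proj_compl_le (x : X Γ) {ε : ℝ} (hε : 0 < ε) :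
    ∃ F : Finset Γ, ‖proj 𝕜 (F : Set Γ)ᶜ x‖ ≤ ε :=
  (approx (𝕜 := 𝕜) x ε hε).imp fun _ hF => hF _ (coord_proj _ _)

theorem exists_countable_proj_compl_eq_zero (x : X Γ) :
    ∃ F : Set Γ, F.Countable ∧ proj 𝕜 Fᶜ x = 0 := by
  choose F hF using fun n : ℕ =>
    exists_finset_norm_proj_compl_le (𝕜 := 𝕜) x (Nat.one_div_pos_of_nat (α := ℝ) (n := n))
  refine ⟨⋃ n, F n, Set.countable_iUnion fun n => (F n).countable_toSet, ?_⟩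
  rw [← norm_le_zero_iff]
  refine ge_of_tendsto' tendsto_one_div_add_atTop_nhds_zero_nat fun n => le_trans ?_ (hF n)
  exact norm_proj_mono (Set.compl_subset_compl.2 (Set.subset_iUnion (fun n => (F n : Set Γ)) n)) x

variable (𝕜 X) in
/-- The unit vector at `i`. -/
noncomputable def single (i : Γ) : X Γ := (exists_single (𝕜 := 𝕜) (X := X) i).choose

theorem coord_single (i : Γ) :
    coord (𝕜 := 𝕜) (single 𝕜 X i) = Set.indicator {i} (fun _ => (1 : 𝕜)) :=
  (exists_single (𝕜 := 𝕜) (X := X) i).choose_spec.1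

theorem coord_single_self (i : Γ) : coord (𝕜 := 𝕜) (single 𝕜 X i) i = 1 := by
  rw [coord_single]; simp

theorem coord_single_ne {i j : Γ} (h : j ≠ i) : coord (𝕜 := 𝕜) (single 𝕜 X i) j = 0 := by
  rw [coord_single]; simp [h]

theorem norm_single_le (i : Γ) : ‖single 𝕜 X i‖ ≤ 1 :=
  (exists_single (𝕜 := 𝕜) (X := X) i).choose_spec.2

theorem coord_sum (F : Finset I) (x : I → X Γ) (γ : Γ) :
    coord (𝕜 := 𝕜) (∑ i ∈ F, x i) γ = ∑ i ∈ F, coord (x i) γ := by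
  rw [map_sum, Finset.sum_apply]

theorem coord_smul (c : 𝕜) (x : X Γ) (γ : Γ) :
    coord (𝕜 := 𝕜) (c • x) γ = c * coord x γ := by
  rw [map_smul]; rfl

theorem proj_finset (F : Finset Γ) (x : X Γ) :
    proj 𝕜 (F : Set Γ) x = ∑ i ∈ F, coord (𝕜 := 𝕜) x i • single 𝕜 X i := by
  classical
  refine ext_coord (𝕜 := 𝕜) fun γ => ?_
  rw [coord_proj, coord_sum]
  simp only [coord_smul, coord_single, Set.indicator_apply, Finset.mem_coe, Set.mem_singleton_iff,
    mul_ite, mul_one, mul_zero, Finset.sum_ite_eq]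

theorem norm_proj_finset_le (F : Finset Γ) (x : X Γ) :
    ‖proj 𝕜 (F : Set Γ) x‖ ≤ ∑ i ∈ F, ‖coord (𝕜 := 𝕜) x i‖ := by
  rw [proj_finset]
  refine norm_sum_le_of_le _ fun i _ => ?_
  rw [norm_smul]
  exact mul_le_of_le_one_right (norm_nonneg _) (norm_single_le i)

/-- An operator is bounded by `C` as soon as it is so on the finitely supported vectors. -/
theorem norm_apply_le_of_finset {Y : Type*} [NormedAddCommGroup Y] [NormedSpace 𝕜 Y]
    (T : X Γ →L[𝕜] Y) (C : ℝ) (x : X Γ)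
    (h : ∀ F : Finset Γ, ‖T (proj 𝕜 (F : Set Γ) x)‖ ≤ C) : ‖T x‖ ≤ C := by
  refine le_of_forall_pos_le_add fun ε hε => ?_
  obtain ⟨F, hF⟩ := exists_finset_norm_proj_compl_le (𝕜 := 𝕜) x
    (div_pos hε (by positivity : 0 < ‖T‖ + 1))
  rw [← proj_add_proj_compl (𝕜 := 𝕜) (F : Set Γ) x, map_add]
  refine (norm_add_le _ _).trans (add_le_add (h F) ((T.le_opNorm _).trans ?_))
  calc ‖T‖ * ‖proj 𝕜 (F : Set Γ)ᶜ x‖ ≤ (‖T‖ + 1) * (ε / (‖T‖ + 1)) := by gcongr; linarith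
    _ = ε := by field_simp

theorem ext_single {Y : Type*} [NormedAddCommGroup Y] [NormedSpace 𝕜 Y]
    {S T : X Γ →L[𝕜] Y} (h : ∀ i, S (single 𝕜 X i) = T (single 𝕜 X i)) : S = T := by
  ext x
  rw [← sub_eq_zero, ← sub_apply, ← norm_le_zero_iff]
  refine norm_apply_le_of_finset _ _ _ fun F => ?_
  rw [proj_finset, map_sum, Finset.sum_eq_zero, norm_zero]
  intro i _
  rw [map_smul, sub_apply, h, sub_self, smul_zero]

/-- The operator that sends the unit vectors to a disjoint family of vectors. -/
theorem exists_synthesis (x : I → X Γ)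
    (hx : ∀ i j γ, coord (𝕜 := 𝕜) (x i) γ ≠ 0 → coord (𝕜 := 𝕜) (x j) γ ≠ 0 → i = j)
    (hx1 : ∀ i, ‖x i‖ ≤ 1) :
    ∃ W : X I →L[𝕜] X Γ, (∀ a, ‖W a‖ ≤ ‖a‖) ∧ ∀ i, W (single 𝕜 X i) = x i := by
  choose W h1 h2 h3 using synthesis (𝕜 := 𝕜) x hx hx1
  have key : ∀ a (z : X Γ), (∀ i γ, coord (𝕜 := 𝕜) (x i) γ ≠ 0 →
      coord (𝕜 := 𝕜) z γ = coord a i * coord (x i) γ) →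
      (∀ γ, (∀ i, coord (𝕜 := 𝕜) (x i) γ = 0) → coord (𝕜 := 𝕜) z γ = 0) → W a = z := by
    intro a z hz1 hz2
    refine ext_coord (𝕜 := 𝕜) fun γ => ?_
    by_cases h : ∀ i, coord (𝕜 := 𝕜) (x i) γ = 0
    · rw [h2 a γ h, hz2 γ h]
    · push Not at h
      obtain ⟨i, hi⟩ := h
      rw [h1 a i γ hi, hz1 i γ hi]
  refine ⟨LinearMap.mkContinuous
    { toFun := W
      map_add' := fun a b => key _ _ (fun i γ h => ?_) fun γ h => ?_
      map_smul' := fun c a => key _ _ (fun i γ h => ?_) fun γ h => ?_ } 1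
      fun a => by simpa using h3 a, h3, fun i => key _ _ (fun j γ h => ?_) fun γ h => h i⟩
  · rw [map_add, map_add, Pi.add_apply, Pi.add_apply, h1 a i γ h, h1 b i γ h, add_mul]
  · rw [map_add, Pi.add_apply, h2 a γ h, h2 b γ h, add_zero]
  · rw [RingHom.id_apply, coord_smul, coord_smul, h1 a i γ h, mul_assoc]
  · rw [RingHom.id_apply, coord_smul, h2 a γ h, mul_zero]
  · by_cases hij : j = i
    · rw [hij, coord_single_self, one_mul]
    · rw [coord_single_ne hij, zero_mul]
      by_contra h'
      exact hij (hx j i γ h h')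

/-- The operator whose coordinates are functionals on disjoint blocks. -/
theorem exists_analysis (B : I → Set Γ) (hB : Pairwise fun i j => Disjoint (B i) (B j))
    (φ : I → X Γ →L[𝕜] 𝕜) {C : ℝ} (hC : 0 < C) (hφ : ∀ i, ‖φ i‖ ≤ C) :
    ∃ V : X Γ →L[𝕜] X I, (∀ x, ‖V x‖ ≤ C * ‖x‖) ∧
      ∀ x i, coord (𝕜 := 𝕜) (V x) i = φ i (proj 𝕜 (B i) x) := by
  have h : ∀ x : X Γ, ∃ z : X I, coord (𝕜 := 𝕜) z = (fun i => φ i (proj 𝕜 (B i) x)) ∧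
      ‖z‖ ≤ C * ‖x‖ := by
    intro x
    have hC' : ‖(C : 𝕜)‖ = C := by rw [RCLike.norm_ofReal, abs_of_pos hC]
    obtain ⟨z, hz, hz'⟩ := analysis (𝕜 := 𝕜) B hB ((C : 𝕜) • x)
      (fun i => proj 𝕜 (B i) ((C : 𝕜) • x)) (fun i => φ i (proj 𝕜 (B i) x))
      (fun i => coord_proj _ _) fun i => by
        rw [map_smul, norm_smul, hC']
        exact ((φ i).le_opNorm _).trans (by gcongr; exact hφ i)
    exact ⟨z, hz, by rwa [norm_smul, hC'] at hz'⟩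
  choose V h1 h2 using h
  refine ⟨LinearMap.mkContinuous
    { toFun := V
      map_add' := fun x y => coord_injective (𝕜 := 𝕜) ?_
      map_smul' := fun c x => coord_injective (𝕜 := 𝕜) ?_ } C h2, h2, fun x i => ?_⟩
  · rw [map_add, h1, h1, h1]
    ext i
    simp
  · rw [RingHom.id_apply, map_smul, h1, h1]
    ext i
    simp
  · exact congrFun (h1 x) i

variable (𝕜) in
/-- The coordinate functional at `i`. -/
noncomputable def coordCLM (i : Γ) : X Γ →L[𝕜] 𝕜 :=
  LinearMap.mkContinuous ((LinearMap.proj i).comp (coord (𝕜 := 𝕜))) 1 fun x => by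
    simpa using norm_coord_le x i

theorem coordCLM_apply (i : Γ) (x : X Γ) : coordCLM 𝕜 i x = coord (𝕜 := 𝕜) x i := rfl

theorem norm_coordCLM_le (i : Γ) : ‖(coordCLM 𝕜 i : X Γ →L[𝕜] 𝕜)‖ ≤ 1 :=
  LinearMap.mkContinuous_norm_le _ zero_le_one _

/-- An injection `I → Γ` makes `X I` a complemented subspace of `X Γ`. -/
theorem exists_factor_of_injective {j : I → Γ} (hj : Function.Injective j) :
    ∃ (U : X I →L[𝕜] X Γ) (V : X Γ →L[𝕜] X I), V ∘L U = ContinuousLinearMap.id 𝕜 (X I) ∧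
      U ∘L V = proj 𝕜 (Set.range j) := by
  obtain ⟨U, -, hU⟩ := exists_synthesis (𝕜 := 𝕜) (fun i => single 𝕜 X (j i))
    (fun i i' γ h h' => by
      have h1 : γ = j i := by_contra fun hne => h (coord_single_ne hne)
      have h2 : γ = j i' := by_contra fun hne => h' (coord_single_ne hne)
      exact hj (h1.symm.trans h2)) fun i => norm_single_le _
  obtain ⟨V, -, hV⟩ := exists_analysis (𝕜 := 𝕜) (X := X) (fun i => ({j i} : Set Γ))
    (fun i i' h => by simpa using fun h' => h (hj h'))
    (fun i => coordCLM 𝕜 (j i)) one_pos fun i => norm_coordCLM_le _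
  have hV' : ∀ x i, coord (𝕜 := 𝕜) (V x) i = coord x (j i) := fun x i => by
    rw [hV, coordCLM_apply, coord_proj]; simp
  have hVs : ∀ i, V (single 𝕜 X (j i)) = single 𝕜 X i := fun i => by
    refine ext_coord (𝕜 := 𝕜) fun k => ?_
    rw [hV']
    by_cases hk : k = i
    · rw [hk, coord_single_self, coord_single_self]
    · rw [coord_single_ne hk, coord_single_ne fun h => hk (hj h)]
  refine ⟨U, V, ext_single fun i => ?_, ext_single fun γ => ?_⟩
  · simp [hU, hVs]
  · by_cases hγ : γ ∈ Set.range j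
    · obtain ⟨i, rfl⟩ := hγ
      simp only [ContinuousLinearMap.comp_apply, hVs, hU]
      refine (proj_eq_self fun δ hδ => coord_single_ne ?_).symm
      rintro rfl
      exact hδ ⟨i, rfl⟩
    · have h0 : V (single 𝕜 X γ) = 0 := ext_coord (𝕜 := 𝕜) fun k => by
        rw [hV', coord_single_ne fun h => hγ ⟨k, h⟩]; simp
      rw [ContinuousLinearMap.comp_apply, h0, map_zero]
      refine ext_coord (𝕜 := 𝕜) fun δ => ?_
      rw [coord_proj]
      by_cases hδ : δ ∈ Set.range j
      · rw [Set.indicator_of_mem hδ, coord_single_ne (by rintro rfl; exact hγ hδ)]; simp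
      · rw [Set.indicator_of_notMem hδ]; simp

end SequenceSpace

/-! ### Transfinite recursive choice -/

/-- Recursive choice along a well-founded relation. -/
theorem exists_forall_of_wellFounded {I : Type*} {C : Type*} {r : I → I → Prop}
    (hr : WellFounded r) (Q : ∀ i, ({j // r j i} → C) → C → Prop) (h : ∀ i s, ∃ c, Q i s c) :
    ∃ f : I → C, ∀ i, Q i (fun j => f j) (f i) := by
  choose g hg using h
  refine ⟨hr.fix fun i f => g i fun j => f j.1 j.2, fun i => ?_⟩
  have := hg i fun j => hr.fix (fun i f => g i fun j => f j.1 j.2) j.1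
  rwa [hr.fix_eq (fun i f => g i fun j => f j.1 j.2) i]

/-! ### Density counting and perturbation of block diagonal operators -/

namespace SequenceSpace

/-- A bounded separated family in `X K` has at most `#K` members. -/
theorem mk_le_of_separated (𝕜 : Type w) [RCLike 𝕜] {X : Type u → Type v}
    [∀ Γ, NormedAddCommGroup (X Γ)] [∀ Γ, NormedSpace 𝕜 (X Γ)] [SequenceSpace 𝕜 X]
    {I K : Type u} (hI : ℵ₀ ≤ #I) (b : I → X K) {M δ : ℝ} (hM : ∀ i, ‖b i‖ ≤ M)
    (hδ : 0 < δ) (hb : ∀ i j, i ≠ j → δ ≤ ‖b i - b j‖) : #I ≤ #K := by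
  choose F hF using fun i =>
    exists_finset_norm_proj_compl_le (𝕜 := 𝕜) (b i) (by positivity : 0 < δ / 4)
  -- By Bolzano–Weierstrass, an infinite fibre has two members within `δ / 4` of each other on `G`.
  -- With two tails of size `δ / 4` their distance is at most `3δ / 4`, against separation.
  have hfib : ∀ G, (F ⁻¹' {G}).Finite := by
    intro G
    by_contra hinf
    have hinf : (F ⁻¹' {G}).Infinite := hinf
    let e := hinf.natEmbedding
    have hG : ∀ n, F (e n) = G := fun n => (e n).2
    obtain ⟨a, -, φ, hφ, ha⟩ := tendsto_subseq_of_bounded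
      (Metric.isBounded_closedBall (x := (0 : G → 𝕜)) (r := max M 0))
      (x := fun n (γ : G) => coord (𝕜 := 𝕜) (b (e n)) γ) fun n => by
        rw [mem_closedBall_zero_iff, pi_norm_le_iff_of_nonneg (le_max_right _ _)]
        exact fun γ => (norm_coord_le _ _).trans ((hM _).trans (le_max_left _ _))
    obtain ⟨N, hN⟩ := Metric.cauchySeq_iff.1 ha.cauchySeq (δ / (4 * (G.card + 1)))
      (by positivity)
    have hd := hN N le_rfl (N + 1) (Nat.le_succ N)
    have hne : (e (φ N) : I) ≠ e (φ (N + 1)) := fun h =>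
      (Nat.lt_succ_self N).ne (hφ.injective (e.injective (Subtype.ext h)))
    have h1 := hb _ _ hne
    rw [dist_eq_norm] at hd
    set x := b (e (φ N))
    set y := b (e (φ (N + 1)))
    have hx : ‖proj 𝕜 (G : Set K)ᶜ x‖ ≤ δ / 4 := by rw [← hG (φ N)]; exact hF _
    have hy : ‖proj 𝕜 (G : Set K)ᶜ y‖ ≤ δ / 4 := by rw [← hG (φ (N + 1))]; exact hF _
    have h2 : ‖proj 𝕜 (G : Set K) (x - y)‖ ≤ δ / 4 := by
      refine (norm_proj_finset_le _ _).trans ?_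
      calc _ ≤ ∑ _γ ∈ G, δ / (4 * (G.card + 1)) := Finset.sum_le_sum fun γ hγ => by
            refine le_trans ?_ hd.le
            rw [map_sub]
            exact norm_le_pi_norm
              ((fun γ : G => coord (𝕜 := 𝕜) x γ) - fun γ : G => coord (𝕜 := 𝕜) y γ) ⟨γ, hγ⟩
        _ ≤ δ / 4 := by
            rw [Finset.sum_const, nsmul_eq_mul, mul_div_assoc', div_le_div_iff₀ (by positivity)
              (by positivity)]
            nlinarith
    have h3 := norm_add_le (proj 𝕜 (G : Set K) (x - y)) (proj 𝕜 (G : Set K)ᶜ (x - y))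
    rw [proj_add_proj_compl, map_sub (proj 𝕜 (G : Set K)ᶜ) x y] at h3
    have h4 := norm_sub_le (proj 𝕜 (G : Set K)ᶜ x) (proj 𝕜 (G : Set K)ᶜ y)
    linarith
  have : Infinite I := Cardinal.infinite_iff.2 hI
  rcases finite_or_infinite K with hK | hK
  · obtain ⟨G, hG⟩ := Finite.exists_infinite_fiber F
    exact absurd (hfib G) (Set.infinite_coe_iff.1 hG)
  · refine (Cardinal.mk_le_mk_mul_of_mk_preimage_le F fun G =>
      (hfib G).countable.le_aleph0).trans ?_
    rw [Cardinal.mk_finset_of_infinite]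
    exact (Cardinal.mul_aleph0_eq (Cardinal.aleph0_le_mk K)).le

variable {𝕜 : Type w} [RCLike 𝕜] {X : Type u → Type v}
  [∀ Γ, NormedAddCommGroup (X Γ)] [∀ Γ, NormedSpace 𝕜 (X Γ)] [SequenceSpace 𝕜 X]
  {Γ Λ I K : Type u}

/-- If `S W` is close to a block diagonal operator, then `S W` is left invertible. -/
theorem exists_left_inverse_of_blocks [CompleteSpace (X I)]
    (S : X Γ →L[𝕜] X Λ) (W : X I →L[𝕜] X Γ) (B : I → Set Λ)
    (hB : Pairwise fun i j => Disjoint (B i) (B j)) {s : ℝ} (hs : 0 < s)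
    (hsB : ∀ i, s ≤ ‖proj 𝕜 (B i) (S (W (single 𝕜 X i)))‖) (δ : I → ℝ)
    (hδ : ∀ i, ‖proj 𝕜 (B i)ᶜ (S (W (single 𝕜 X i)))‖ ≤ δ i)
    (hR : ∀ R : X I →L[𝕜] X I, (∀ i, ‖R (single 𝕜 X i)‖ ≤ δ i / s) → ‖R‖ < 1) :
    ∃ V : X Λ →L[𝕜] X I, V ∘L S ∘L W = ContinuousLinearMap.id 𝕜 (X I) := by
  choose g hg1 hg2 using fun i => exists_dual_vector'' 𝕜 (proj 𝕜 (B i) (S (W (single 𝕜 X i))))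
  have hpos : ∀ i, 0 < ‖proj 𝕜 (B i) (S (W (single 𝕜 X i)))‖ := fun i => hs.trans_le (hsB i)
  obtain ⟨V, hV1, hV2⟩ := exists_analysis (𝕜 := 𝕜) B hB
    (fun i => ((‖proj 𝕜 (B i) (S (W (single 𝕜 X i)))‖⁻¹ : ℝ) : 𝕜) • g i) (inv_pos.2 hs)
    fun i => by
      rw [norm_smul, RCLike.norm_ofReal, abs_of_pos (inv_pos.2 (hpos i))]
      calc _ ≤ s⁻¹ * 1 := by
            gcongr
            · exact hsB i
            · exact hg1 i
        _ = s⁻¹ := mul_one _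
  -- The norming functionals are scaled to give exactly one on the diagonal blocks, so only the part
  -- of the image outside `B i` contributes to the error.
  have hRe : ∀ i, single 𝕜 X i - V (S (W (single 𝕜 X i))) =
      -V (proj 𝕜 (B i)ᶜ (S (W (single 𝕜 X i)))) := fun i => by
    refine ext_coord (𝕜 := 𝕜) fun k => ?_
    rw [map_sub, map_neg, Pi.sub_apply, Pi.neg_apply, hV2, hV2, proj_proj]
    by_cases hk : k = i
    · subst hk
      have h0 : proj 𝕜 (B k ∩ (B k)ᶜ) (S (W (single 𝕜 X k))) = 0 :=
        coord_injective (𝕜 := 𝕜) <| by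
          rw [coord_proj, Set.inter_compl_self, Set.indicator_empty, map_zero]; rfl
      rw [h0, coord_single_self, map_zero, neg_zero, smul_apply, hg2, smul_eq_mul,
        ← RCLike.ofReal_mul, inv_mul_cancel₀ (hpos k).ne', RCLike.ofReal_one, sub_self]
    · rw [Set.inter_eq_left.2 (hB hk).subset_compl_right, coord_single_ne hk, zero_sub]
  set R : X I →L[𝕜] X I := ContinuousLinearMap.id 𝕜 (X I) - V ∘L S ∘L W with hRdef
  have hR1 : ‖R‖ < 1 := hR R fun i => by
    have : R (single 𝕜 X i) = single 𝕜 X i - V (S (W (single 𝕜 X i))) := rfl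
    rw [this, hRe, norm_neg, div_eq_inv_mul]
    exact (hV1 _).trans (by gcongr; exact hδ i)
  obtain ⟨u, hu⟩ := isUnit_one_sub_of_norm_lt_one hR1
  refine ⟨(↑u⁻¹ : X I →L[𝕜] X I) ∘L V, ?_⟩
  have h1 : V ∘L S ∘L W = (u : X I →L[𝕜] X I) := by
    rw [hu, hRdef]; exact (sub_sub_cancel _ _).symm
  rw [ContinuousLinearMap.comp_assoc, h1]
  exact u.inv_mul

/-- An operator is small if the sum of the norms of the images of the unit vectors is small. -/
theorem opNorm_le_of_summable {Y : Type*} [NormedAddCommGroup Y] [NormedSpace 𝕜 Y]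
    (R : X I →L[𝕜] Y) {δ : I → ℝ} (hR : ∀ i, ‖R (single 𝕜 X i)‖ ≤ δ i) {C : ℝ} (hC : 0 ≤ C)
    (hδ : ∀ F : Finset I, ∑ i ∈ F, δ i ≤ C) : ‖R‖ ≤ C := by
  refine R.opNorm_le_bound hC fun x => norm_apply_le_of_finset _ _ _ fun F => ?_
  rw [proj_finset, map_sum]
  calc _ ≤ ∑ i ∈ F, δ i * ‖x‖ := norm_sum_le_of_le _ fun i _ => by
        rw [map_smul, norm_smul, mul_comm]
        exact mul_le_mul (hR i) (norm_coord_le x i) (norm_nonneg _) ((norm_nonneg _).trans (hR i))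
    _ = (∑ i ∈ F, δ i) * ‖x‖ := by rw [Finset.sum_mul]
    _ ≤ C * ‖x‖ := by gcongr; exact hδ F

/-- An operator that is bounded below on `X I` is not close to operators factoring through smaller
spaces `X K`. -/
theorem mk_le_of_norm_sub_comp_le {Y : Type*} [NormedAddCommGroup Y] [NormedSpace 𝕜 Y]
    (hI : ℵ₀ ≤ #I) {S : X I →L[𝕜] Y} {c : ℝ} (hc : 0 < c) (hS : ∀ x, c * ‖x‖ ≤ ‖S x‖)
    (B : X I →L[𝕜] X K) (A : X K →L[𝕜] Y) (h : ‖S - A ∘L B‖ ≤ c / 4) : #I ≤ #K := by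
  -- Differences of unit vectors have norm between 1 and 2, so `A ∘L B` keeps them at least `c - 2 *
  -- (c / 4) = c / 2` in norm, and `B` separates them.
  refine mk_le_of_separated 𝕜 hI (fun i => B (single 𝕜 X i)) (M := ‖B‖)
    (δ := c / 2 / (‖A‖ + 1)) (fun i => ?_) (by positivity) fun i j hij => ?_
  · exact (B.le_opNorm _).trans (mul_le_of_le_one_right (norm_nonneg _) (norm_single_le i))
  · set x := single 𝕜 X i - single 𝕜 X j with hx
    have hx1 : 1 ≤ ‖x‖ := by
      have := norm_coord_le (𝕜 := 𝕜) x i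
      rwa [hx, map_sub, Pi.sub_apply, coord_single_self, coord_single_ne hij, sub_zero,
        norm_one] at this
    have hx2 : ‖x‖ ≤ 2 := (norm_sub_le _ _).trans
      ((add_le_add (norm_single_le i) (norm_single_le j)).trans (by norm_num))
    have h1 : ‖S x - A (B x)‖ ≤ c / 4 * 2 :=
      ((S - A ∘L B).le_of_opNorm_le h x).trans (by gcongr)
    have h2 := hS x
    have h3 := norm_sub_norm_le (S x) (A (B x))
    have h4 : c / 2 ≤ ‖A (B x)‖ := by nlinarith
    have h5 : ‖A (B x)‖ ≤ (‖A‖ + 1) * ‖B x‖ :=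
      (A.le_opNorm _).trans (by gcongr; linarith)
    rw [← map_sub, ← hx, div_le_iff₀ (by positivity), mul_comm]
    linarith

end SequenceSpace

/-! ### Cardinalities of small unions, and disjointification -/

theorem Cardinal.mk_iUnion_lt_of_finite {ι α : Type u} {κ : Cardinal.{u}} (hκ : ℵ₀ ≤ κ)
    (hι : #ι < κ) (f : ι → Set α) (hf : ∀ i, (f i).Finite) : #(⋃ i, f i) < κ := by
  rcases finite_or_infinite ι with h | h
  · exact (Set.finite_iUnion hf).lt_aleph0.trans_le hκ
  · refine ((Cardinal.mk_iUnion_le f).trans ?_).trans_lt hι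
    calc _ ≤ #ι * ℵ₀ := by
          gcongr
          exact ciSup_le' fun i => (hf i).lt_aleph0.le
      _ = #ι := Cardinal.mul_aleph0_eq (Cardinal.aleph0_le_mk ι)

theorem Cardinal.mk_iUnion_lt_of_countable {ι α : Type u} {κ : Cardinal.{u}} (hκ : ℵ₀ < κ)
    (hι : #ι < κ) (f : ι → Set α) (hf : ∀ i, (f i).Countable) : #(⋃ i, f i) < κ := by
  refine (Cardinal.mk_iUnion_le f).trans_lt ?_
  calc _ ≤ #ι * ℵ₀ := by
        gcongr
        exact ciSup_le' fun i => (hf i).le_aleph0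
    _ < κ := Cardinal.mul_lt_of_lt hκ.le hι hκ

theorem Cardinal.mk_union_lt_of_lt {α : Type u} {κ : Cardinal.{u}} (hκ : ℵ₀ ≤ κ)
    {A B : Set α} (hA : #A < κ) (hB : #B < κ) : #(A ∪ B : Set α) < κ :=
  (Cardinal.mk_union_le A B).trans_lt (Cardinal.add_lt_of_lt hκ hA hB)

/-- The sets `F i \ ⋃ j < i, F j` are pairwise disjoint. -/
theorem pairwise_disjoint_diff_iUnion {I α : Type*} (r : I → I → Prop) [IsWellOrder I r]
    (F : I → Set α) :
    Pairwise fun i j =>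
      Disjoint (F i \ ⋃ k : {k // r k i}, F k) (F j \ ⋃ k : {k // r k j}, F k) := by
  intro i j hij
  rw [Set.disjoint_left]
  rintro a ⟨hai, hai'⟩ ⟨haj, haj'⟩
  rcases trichotomous_of r i j with h | h | h
  · exact haj' (Set.mem_iUnion.2 ⟨⟨i, h⟩, hai⟩)
  · exact hij h
  · exact hai' (Set.mem_iUnion.2 ⟨⟨j, h⟩, haj⟩)

/-! ### Almost finite support of functionals, and approximation through smaller spaces -/

namespace SequenceSpace

section

variable (𝕜 : Type w) [RCLike 𝕜] (X : Type u → Type v)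
  [∀ Γ, NormedAddCommGroup (X Γ)] [∀ Γ, NormedSpace 𝕜 (X Γ)] [SequenceSpace 𝕜 X]

/-- The norm of a sum of `N` unit vectors grows more slowly than `N`. -/
def Shrinking : Prop :=
  ∀ ε : ℝ, 0 < ε → ∃ N : ℕ, 0 < N ∧ ∀ (Γ : Type u) (F : Finset Γ), F.card = N →
    ‖∑ i ∈ F, single 𝕜 X i‖ ≤ ε * N

/-- The norm dominates the `ℓ₁`-norm. -/
def IsEllOne : Prop :=
  ∀ (Γ : Type u) (x : X Γ) (F : Finset Γ), ∑ i ∈ F, ‖coord (𝕜 := 𝕜) x i‖ ≤ ‖x‖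

variable {X}

/-- `S` is a norm limit of operators that factor through `X K` with `#K < κ`. -/
def ApproxBySmaller (κ : Cardinal.{u}) {Γ Λ : Type u} (S : X Γ →L[𝕜] X Λ) : Prop :=
  ∀ ε : ℝ, 0 < ε → ∃ (K : Type u) (B : X Γ →L[𝕜] X K) (A : X K →L[𝕜] X Λ),
    #K < κ ∧ ‖S - A ∘L B‖ ≤ ε

end

variable {𝕜 : Type w} [RCLike 𝕜] {X : Type u → Type v}
  [∀ Γ, NormedAddCommGroup (X Γ)] [∀ Γ, NormedSpace 𝕜 (X Γ)] [SequenceSpace 𝕜 X]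
  {Γ Λ I K : Type u}

/-- The identity of `X I` factors through `S`. -/
def IdFactorsThrough (𝕜 : Type w) [RCLike 𝕜] {X : Type u → Type v}
    [∀ Γ, NormedAddCommGroup (X Γ)] [∀ Γ, NormedSpace 𝕜 (X Γ)] (I : Type u) {Γ Λ : Type u}
    (S : X Γ →L[𝕜] X Λ) : Prop :=
  ∃ (W : X I →L[𝕜] X Γ) (V : X Λ →L[𝕜] X I), V ∘L S ∘L W = ContinuousLinearMap.id 𝕜 (X I)

theorem proj_compl_proj_compl {A B : Set Γ} (h : A ⊆ B) (x : X Γ) :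
    proj 𝕜 Aᶜ (proj 𝕜 Bᶜ x) = proj 𝕜 Bᶜ x := by
  rw [proj_proj, Set.inter_eq_right.2 (Set.compl_subset_compl.2 h)]

/-- Supplies one hump: density of the finitely supported vectors allows a witness of largeness off
`D` to be truncated, then normalised. -/
theorem exists_finset_normalized {Y : Type*} [NormedAddCommGroup Y] [NormedSpace 𝕜 Y]
    (T : X Γ →L[𝕜] Y) (D : Set Γ) {ε : ℝ} (hε : 0 ≤ ε)
    (h : ∃ x, ε * ‖x‖ < ‖T (proj 𝕜 Dᶜ x)‖) :
    ∃ (G : Finset Γ) (z : X Γ), (∀ γ, coord (𝕜 := 𝕜) z γ ≠ 0 → γ ∈ G ∧ γ ∉ D) ∧ ‖z‖ ≤ 1 ∧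
      ε < ‖T z‖ := by
  obtain ⟨x, hx⟩ := h
  obtain ⟨G, hG⟩ : ∃ G : Finset Γ, ε * ‖x‖ < ‖T (proj 𝕜 (G : Set Γ) (proj 𝕜 Dᶜ x))‖ := by
    by_contra hcon
    push Not at hcon
    exact (norm_apply_le_of_finset T _ _ hcon).not_gt hx
  set y := proj 𝕜 (G : Set Γ) (proj 𝕜 Dᶜ x) with hy
  have hyx : ‖y‖ ≤ ‖x‖ := (norm_proj_apply_le _ _).trans (norm_proj_apply_le _ _)
  have hy0 : 0 < ‖y‖ := by
    rw [norm_pos_iff]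
    intro h0
    rw [h0, map_zero, norm_zero] at hG
    exact (mul_nonneg hε (norm_nonneg x)).not_gt hG
  refine ⟨G, ((‖y‖⁻¹ : ℝ) : 𝕜) • y, fun γ hγ => ?_, ?_, ?_⟩
  · rw [coord_smul] at hγ
    have := right_ne_zero_of_mul hγ
    rw [hy, proj_proj, coord_proj] at this
    simpa using Set.mem_of_indicator_ne_zero this
  · rw [norm_smul, RCLike.norm_ofReal, abs_of_pos (inv_pos.2 hy0), inv_mul_cancel₀ hy0.ne']
  · rw [map_smul, norm_smul, RCLike.norm_ofReal, abs_of_pos (inv_pos.2 hy0), ← div_eq_inv_mul,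
      lt_div_iff₀ hy0]
    exact (mul_le_mul_of_nonneg_left hyx hε).trans_lt hG

/-- In the shrinking case functionals are small off a finite set. -/
theorem Shrinking.exists_finset_norm_le (hX : Shrinking 𝕜 X) (φ : X Γ →L[𝕜] 𝕜) {ε : ℝ}
    (hε : 0 < ε) : ∃ F : Finset Γ, ∀ x, ‖φ (proj 𝕜 (F : Set Γ)ᶜ x)‖ ≤ ε * ‖x‖ := by
  classical
  by_contra hcon
  push Not at hcon
  -- Otherwise there are disjoint vectors in the unit ball, rotated by unimodular scalars so that
  -- `φ` takes real values at least `ε`. On the sum of `N` of them `φ` is at least `ε * N`, while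
  -- shrinking bounds it by `ε / 2 * N`. The index set is lifted to match the universe of `X`.
  obtain ⟨f, hf⟩ := exists_forall_of_wellFounded (C := Finset Γ × X Γ)
    (r := fun i j : ULift.{u} ℕ => i.down < j.down) (InvImage.wf ULift.down Nat.lt_wfRel.wf)
    (fun i s c => (∀ γ, coord (𝕜 := 𝕜) c.2 γ ≠ 0 → γ ∈ c.1 ∧ ∀ j, γ ∉ (s j).1) ∧ ‖c.2‖ ≤ 1 ∧
      ∃ t : ℝ, ε ≤ t ∧ φ c.2 = t) fun i s => by
    have hfin : Finite {j : ULift.{u} ℕ // j.down < i.down} :=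
      Finite.of_injective (fun j => (⟨j.1.down, j.2⟩ : Fin i.down)) fun a b h =>
        Subtype.ext (ULift.ext _ _ (by simpa using h))
    obtain ⟨G, z, hz, hz1, hz2⟩ := exists_finset_normalized φ (⋃ j, ((s j).1 : Set Γ)) hε.le (by
      have h := hcon (Set.finite_iUnion fun j => ((s j).1 : Set Γ).toFinite).toFinset
      rwa [Set.Finite.coe_toFinset] at h)
    have h0 : φ z ≠ 0 := fun h => by rw [h, norm_zero] at hz2; exact hε.not_gt hz2
    refine ⟨(G, ((‖φ z‖ : ℝ) / φ z : 𝕜) • z), fun γ hγ => ?_, ?_, ‖φ z‖, hz2.le, ?_⟩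
    · rw [coord_smul] at hγ
      simpa using hz γ (right_ne_zero_of_mul hγ)
    · rw [norm_smul, norm_div, RCLike.norm_ofReal, abs_norm, div_self (norm_ne_zero_iff.2 h0),
        one_mul]
      exact hz1
    · rw [map_smul, smul_eq_mul, div_mul_cancel₀ _ h0]
  choose h1 h2 t ht hφ using hf
  obtain ⟨W, hW, hW'⟩ := exists_synthesis (𝕜 := 𝕜) (fun i => (f i).2) (fun i j γ hi hj => by
    rcases lt_trichotomy i.down j.down with h | h | h
    · exact absurd (h1 i γ hi).1 ((h1 j γ hj).2 ⟨i, h⟩)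
    · exact ULift.ext _ _ h
    · exact absurd (h1 j γ hj).1 ((h1 i γ hi).2 ⟨j, h⟩)) h2
  obtain ⟨N, hN, hN'⟩ := hX (ε / (2 * (‖φ‖ + 1))) (by positivity)
  let F : Finset (ULift.{u} ℕ) := (Finset.range N).map Equiv.ulift.symm.toEmbedding
  have hF : F.card = N := by simp [F]
  have hsum : φ (W (∑ i ∈ F, single 𝕜 X i)) = ((∑ i ∈ F, t i : ℝ) : 𝕜) := by
    rw [map_sum, map_sum, RCLike.ofReal_sum]
    exact Finset.sum_congr rfl fun i _ => by rw [hW', hφ]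
  have hlow : ε * N ≤ ∑ i ∈ F, t i := by
    calc ε * N = ∑ _i ∈ F, ε := by rw [Finset.sum_const, hF, nsmul_eq_mul, mul_comm]
      _ ≤ _ := Finset.sum_le_sum fun i _ => ht i
  have hup : ∑ i ∈ F, t i ≤ ‖φ‖ * (ε / (2 * (‖φ‖ + 1)) * N) := by
    calc _ ≤ ‖((∑ i ∈ F, t i : ℝ) : 𝕜)‖ := by rw [RCLike.norm_ofReal]; exact le_abs_self _
      _ ≤ ‖φ‖ * ‖W (∑ i ∈ F, single 𝕜 X i)‖ := by rw [← hsum]; exact φ.le_opNorm _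
      _ ≤ _ := by
        gcongr
        exact (hW _).trans (hN' _ F hF)
  have hN0 : (0 : ℝ) < N := by exact_mod_cast hN
  have : ‖φ‖ * (ε / (2 * (‖φ‖ + 1)) * N) ≤ ε / 2 * N := by
    have : ‖φ‖ * (ε / (2 * (‖φ‖ + 1))) ≤ ε / 2 := by
      rw [mul_div_assoc', div_le_div_iff₀ (by positivity) (by positivity)]
      nlinarith [norm_nonneg φ]
    calc _ = ‖φ‖ * (ε / (2 * (‖φ‖ + 1))) * N := by ring
      _ ≤ _ := by gcongr
  nlinarith

/-- The union of the finite exceptional sets for the bounds `1 / (n + 1)` serves. -/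
theorem Shrinking.exists_countable_eq_zero (hX : Shrinking 𝕜 X) (φ : X Γ →L[𝕜] 𝕜) :
    ∃ F : Set Γ, F.Countable ∧ ∀ x, φ (proj 𝕜 Fᶜ x) = 0 := by
  choose F hF using fun n : ℕ =>
    hX.exists_finset_norm_le φ (Nat.one_div_pos_of_nat (α := ℝ) (n := n))
  refine ⟨⋃ n, F n, Set.countable_iUnion fun n => (F n).countable_toSet, fun x => ?_⟩
  rw [← norm_le_zero_iff]
  have hlim := (tendsto_one_div_add_atTop_nhds_zero_nat (𝕜 := ℝ)).mul_const ‖x‖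
  rw [zero_mul] at hlim
  refine ge_of_tendsto' hlim fun n => ?_
  have h := hF n (proj 𝕜 (⋃ n, (F n : Set Γ))ᶜ x)
  rw [proj_compl_proj_compl (Set.subset_iUnion (fun n => (F n : Set Γ)) n)] at h
  exact h.trans (by gcongr; exact norm_proj_apply_le _ _)

/-- Each of the finitely many coordinates of `S` in `E` is a functional, small off a finite set.
This and its exact analogue `Shrinking.exists_proj_eq_zero` keep later humps away from earlier
images. -/
theorem Shrinking.exists_finite_norm_proj_le (hX : Shrinking 𝕜 X) (S : X Γ →L[𝕜] X Λ)
    {E : Set Λ} (hE : E.Finite) {δ : ℝ} (hδ : 0 < δ) :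
    ∃ D : Set Γ, D.Finite ∧ ∀ x, ‖proj 𝕜 E (S (proj 𝕜 Dᶜ x))‖ ≤ δ * ‖x‖ := by
  lift E to Finset Λ using hE
  choose F hF using fun γ : Λ => hX.exists_finset_norm_le (coordCLM 𝕜 γ ∘L S)
    (by positivity : 0 < δ / (E.card + 1))
  refine ⟨⋃ γ ∈ E, F γ, E.finite_toSet.biUnion fun γ _ => (F γ).finite_toSet, fun x => ?_⟩
  refine (norm_proj_finset_le _ _).trans ?_
  calc _ ≤ ∑ _γ ∈ E, δ / (E.card + 1) * ‖x‖ := Finset.sum_le_sum fun γ hγ => by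
        have h := hF γ (proj 𝕜 (⋃ γ ∈ E, (F γ : Set Γ))ᶜ x)
        rw [proj_compl_proj_compl (Set.subset_iUnion₂
          (s := fun γ (_ : γ ∈ E) => (F γ : Set Γ)) γ hγ)] at h
        exact h.trans (by gcongr; exact norm_proj_apply_le _ _)
    _ = (E.card * (δ / (E.card + 1))) * ‖x‖ := by
        rw [Finset.sum_const, nsmul_eq_mul, mul_assoc]
    _ ≤ δ * ‖x‖ := by
        gcongr
        rw [mul_div_assoc', div_le_iff₀ (by positivity)]
        nlinarith

theorem Shrinking.exists_proj_eq_zero (hX : Shrinking 𝕜 X) (S : X Γ →L[𝕜] X Λ)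
    {κ : Cardinal.{u}} (hκ : ℵ₀ < κ) {E : Set Λ} (hE : #E < κ) :
    ∃ D : Set Γ, #D < κ ∧ ∀ x, proj 𝕜 E (S (proj 𝕜 Dᶜ x)) = 0 := by
  choose F hF hF' using fun γ : Λ => hX.exists_countable_eq_zero (coordCLM 𝕜 γ ∘L S)
  refine ⟨⋃ γ : E, F γ, Cardinal.mk_iUnion_lt_of_countable hκ hE _ fun γ => hF γ,
    fun x => ext_coord (𝕜 := 𝕜) fun γ => ?_⟩
  rw [coord_proj, map_zero]
  by_cases hγ : γ ∈ E
  · rw [Set.indicator_of_mem hγ]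
    have h := hF' γ (proj 𝕜 (⋃ γ : E, F γ)ᶜ x)
    rwa [proj_compl_proj_compl (Set.subset_iUnion (fun γ : E => F γ) ⟨γ, hγ⟩)] at h
  · rw [Set.indicator_of_notMem hγ]; rfl

theorem ApproxBySmaller.of_domain {κ : Cardinal.{u}} {S : X Γ →L[𝕜] X Λ}
    (h : ∀ ε : ℝ, 0 < ε → ∃ D : Set Γ, #D < κ ∧ ∀ x, ‖S (proj 𝕜 Dᶜ x)‖ ≤ ε * ‖x‖) :
    ApproxBySmaller 𝕜 κ S := by
  intro ε hε
  obtain ⟨D, hD, hS⟩ := h ε hε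
  obtain ⟨U, V, -, hUV⟩ := exists_factor_of_injective (𝕜 := 𝕜) (X := X)
    (Subtype.val_injective (p := (· ∈ D)))
  refine ⟨D, V, S ∘L U, hD, ContinuousLinearMap.opNorm_le_bound _ hε.le fun x => ?_⟩
  have : (S - (S ∘L U) ∘L V) x = S (proj 𝕜 Dᶜ x) := by
    rw [ContinuousLinearMap.comp_assoc, hUV, Subtype.range_val, sub_apply,
      ContinuousLinearMap.comp_apply, ← map_sub, sub_proj]
  rw [this]
  exact hS x

theorem ApproxBySmaller.of_codomain {κ : Cardinal.{u}} {S : X Γ →L[𝕜] X Λ}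
    (h : ∀ ε : ℝ, 0 < ε → ∃ D : Set Λ, #D < κ ∧ ‖proj 𝕜 Dᶜ ∘L S‖ ≤ ε) :
    ApproxBySmaller 𝕜 κ S := by
  intro ε hε
  obtain ⟨D, hD, hS⟩ := h ε hε
  obtain ⟨U, V, -, hUV⟩ := exists_factor_of_injective (𝕜 := 𝕜) (X := X)
    (Subtype.val_injective (p := (· ∈ D)))
  refine ⟨D, V ∘L S, U, hD, ?_⟩
  have : S - U ∘L V ∘L S = proj 𝕜 Dᶜ ∘L S := by
    ext x
    rw [← ContinuousLinearMap.comp_assoc, hUV, Subtype.range_val, sub_apply,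
      ContinuousLinearMap.comp_apply, sub_proj, ContinuousLinearMap.comp_apply]
  rwa [this]

end SequenceSpace

/-! ### The transfinite gliding hump and the dichotomy -/

namespace SequenceSpace

variable {𝕜 : Type w} [RCLike 𝕜] {X : Type u → Type v}
  [∀ Γ, NormedAddCommGroup (X Γ)] [∀ Γ, NormedSpace 𝕜 (X Γ)] [SequenceSpace 𝕜 X]
  {Γ Λ I K : Type u}

/-- The transfinite gliding hump: if `S` is not small off any set of fewer than `#I` elements, then
the identity of `X I` factors through `S`. -/
theorem idFactorsThrough_of_blocks [CompleteSpace (X I)] {r : I → I → Prop} [IsWellOrder I r]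
    (hI : ℵ₀ ≤ #I) (hr : ∀ i, #{j // r j i} < #I) (S : X Γ →L[𝕜] X Λ) (P : Set Λ → Prop)
    (δ : I → ℝ) {ε : ℝ} (hε : 0 < ε) (hδ0 : ∀ i, 0 ≤ δ i)
    (hδ : ∀ F : Finset I, ∑ i ∈ F, δ i ≤ ε / 8)
    (hP : ∀ i (f : {j // r j i} → Set Λ), (∀ j, P (f j)) → #(⋃ j, f j) < #I)
    (h1 : ∀ i (y : X Λ), ∃ F, P F ∧ ‖proj 𝕜 Fᶜ y‖ ≤ δ i)
    (h2 : ∀ i (E : Set Λ), #E < #I → ∃ D : Set Γ, #D < #I ∧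
      ∀ x, ‖proj 𝕜 E (S (proj 𝕜 Dᶜ x))‖ ≤ δ i * ‖x‖)
    (hS : ∀ D : Set Γ, #D < #I → ∃ x, ε * ‖x‖ < ‖S (proj 𝕜 Dᶜ x)‖) :
    IdFactorsThrough 𝕜 I S := by
  -- Each stage records a finite set carrying the hump, the hump itself, and an essential support of
  -- its image. The new hump avoids the earlier carriers, and also the set `D` off which `S` hardly
  -- reaches the earlier essential supports.
  obtain ⟨f, hf⟩ := exists_forall_of_wellFounded (C := Finset Γ × X Γ × {F : Set Λ // P F})
    (r := r) IsWellFounded.wf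
    (fun i s c => (∀ γ, coord (𝕜 := 𝕜) c.2.1 γ ≠ 0 → γ ∈ c.1 ∧ ∀ j, γ ∉ (s j).1) ∧ ‖c.2.1‖ ≤ 1 ∧
      ε < ‖S c.2.1‖ ∧ ‖proj 𝕜 (⋃ j, ((s j).2.2 : Set Λ)) (S c.2.1)‖ ≤ δ i ∧
      ‖proj 𝕜 (c.2.2 : Set Λ)ᶜ (S c.2.1)‖ ≤ δ i) fun i s => by
    obtain ⟨D, hD, hD'⟩ := h2 i (⋃ j, ((s j).2.2 : Set Λ)) (hP i _ fun j => (s j).2.2.2)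
    obtain ⟨G, z, hz, hz1, hz2⟩ := exists_finset_normalized S (D ∪ ⋃ j, ((s j).1 : Set Γ)) hε.le
      (hS _ (Cardinal.mk_union_lt_of_lt hI hD
        (Cardinal.mk_iUnion_lt_of_finite hI (hr i) _ fun j => (s j).1.finite_toSet)))
    obtain ⟨F, hF, hF'⟩ := h1 i (S z)
    refine ⟨(G, z, ⟨F, hF⟩), fun γ hγ => ?_, hz1, hz2, ?_, hF'⟩
    · have := hz γ hγ
      simp only [Set.mem_union, Set.mem_iUnion, Finset.mem_coe, not_or, not_exists] at this
      exact ⟨this.1, this.2.2⟩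
    · have hzD : proj 𝕜 Dᶜ z = z := proj_eq_self fun γ hγ => by
        by_contra h
        exact hγ fun h' => (hz γ h).2 (Or.inl h')
      have := hD' z
      rw [hzD] at this
      exact this.trans (mul_le_of_le_one_right (hδ0 i) hz1)
  choose hf1 hf2 hf3 hf4 hf5 using hf
  obtain ⟨W, -, hW⟩ := exists_synthesis (𝕜 := 𝕜) (fun i => (f i).2.1) (fun i j γ hi hj => by
    rcases trichotomous_of r i j with h | h | h
    · exact absurd (hf1 i γ hi).1 ((hf1 j γ hj).2 ⟨i, h⟩)
    · exact h
    · exact absurd (hf1 j γ hj).1 ((hf1 i γ hi).2 ⟨j, h⟩)) hf2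
  let F : I → Set Λ := fun i => (f i).2.2
  have hcompl : ∀ i, ‖proj 𝕜 (F i \ ⋃ k : {k // r k i}, F k)ᶜ (S (W (single 𝕜 X i)))‖ ≤
      2 * δ i := fun i => by
    have h : (F i \ ⋃ k : {k // r k i}, F k)ᶜ = (⋃ k : {k // r k i}, F k) ∪ (F i)ᶜ := by
      rw [Set.sdiff_eq, Set.compl_inter, compl_compl, Set.union_comm]
    rw [h, hW, two_mul]
    exact (norm_proj_union_le _ _ _).trans (add_le_add (hf4 i) (hf5 i))
  refine ⟨W, exists_left_inverse_of_blocks S W (fun i => F i \ ⋃ k : {k // r k i}, F k)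
    (pairwise_disjoint_diff_iUnion r F) (half_pos hε) (fun i => ?_) (fun i => 2 * δ i) hcompl
    fun R hR => ?_⟩
  · have h3 := norm_add_le (proj 𝕜 (F i \ ⋃ k : {k // r k i}, F k) (S (W (single 𝕜 X i))))
      (proj 𝕜 (F i \ ⋃ k : {k // r k i}, F k)ᶜ (S (W (single 𝕜 X i))))
    rw [proj_add_proj_compl] at h3
    have h4 := hcompl i
    have h5 := hf3 i
    have h6 := hδ {i}
    rw [Finset.sum_singleton] at h6
    rw [← hW] at h5
    linarith
  -- The errors `2 * δ i / (ε / 2)` sum to at most `(2 * (ε / 8)) / (ε / 2) = 1 / 2`.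
  · refine (opNorm_le_of_summable R hR (C := 1 / 2) (by norm_num) fun G => ?_).trans_lt
      (by norm_num)
    rw [← Finset.sum_div, ← Finset.mul_sum, div_le_iff₀ (half_pos hε)]
    linarith [hδ G]

theorem Shrinking.approxBySmaller_or_idFactorsThrough (hX : Shrinking 𝕜 X) [CompleteSpace (X I)]
    (hI : ℵ₀ ≤ #I) (S : X Γ →L[𝕜] X Λ) : ApproxBySmaller 𝕜 #I S ∨ IdFactorsThrough 𝕜 I S := by
  refine or_iff_not_imp_left.2 fun hS => ?_
  have hS' := mt ApproxBySmaller.of_domain hS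
  push Not at hS'
  obtain ⟨ε, hε, hS'⟩ := hS'
  -- A well-order whose type is the initial ordinal has all proper initial segments of smaller
  -- cardinality.
  obtain ⟨r, hwo, hr⟩ := Cardinal.exists_ord_eq I
  have hr' : ∀ i, #{j // r j i} < #I := fun i => by
    simpa [Ordinal.card_typein] using Cardinal.card_typein_lt i hr
  -- For countable `I` only finite supports stay below `#I`, so positive summable errors are needed;
  -- for uncountable `I` countable supports are allowed and all errors vanish.
  rcases hI.eq_or_lt with hI0 | hI0
  · have : Countable I := Cardinal.mk_le_aleph0_iff.1 hI0.ge
    have : Encodable I := Encodable.ofCountable I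
    obtain ⟨δ, hδ, c, hc, hcε⟩ := posSumOfEncodable (by positivity : 0 < ε / 8) I
    refine idFactorsThrough_of_blocks (r := r) hI hr' S Set.Finite δ hε (fun i => (hδ i).le)
      (fun F => (sum_le_hasSum F (fun i _ => (hδ i).le) hc).trans hcε)
      (fun i f hf => Cardinal.mk_iUnion_lt_of_finite hI (hr' i) f hf) (fun i y => ?_)
      (fun i E hE => ?_) hS'
    · obtain ⟨F, hF⟩ := exists_finset_norm_proj_compl_le (𝕜 := 𝕜) y (hδ i)
      exact ⟨F, F.finite_toSet, hF⟩
    · rw [← hI0] at hE ⊢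
      obtain ⟨D, hD, hD'⟩ := hX.exists_finite_norm_proj_le S
        (Cardinal.lt_aleph0_iff_set_finite.1 hE) (hδ i)
      exact ⟨D, hD.lt_aleph0, hD'⟩
  · refine idFactorsThrough_of_blocks (r := r) hI hr' S Set.Countable 0 hε (fun _ => le_rfl)
      (fun F => by simpa using (by positivity : 0 ≤ ε / 8))
      (fun i f hf => Cardinal.mk_iUnion_lt_of_countable hI0 (hr' i) f hf) (fun i y => ?_)
      (fun i E hE => ?_) hS'
    · obtain ⟨F, hF, hF'⟩ := exists_countable_proj_compl_eq_zero (𝕜 := 𝕜) y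
      exact ⟨F, hF, by rw [hF', norm_zero]; rfl⟩
    · obtain ⟨D, hD, hD'⟩ := hX.exists_proj_eq_zero S hI0 hE
      exact ⟨D, hD, fun x => by rw [hD', norm_zero, Pi.zero_apply, zero_mul]⟩

theorem norm_le_of_sum_norm_coord_le (x : X Γ) {C : ℝ}
    (h : ∀ F : Finset Γ, ∑ i ∈ F, ‖coord (𝕜 := 𝕜) x i‖ ≤ C) : ‖x‖ ≤ C :=
  norm_apply_le_of_finset (ContinuousLinearMap.id 𝕜 (X Γ)) C x fun F =>
    (norm_proj_finset_le F x).trans (h F)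

theorem IsEllOne.norm_proj_add_norm_proj_compl_le (hX : IsEllOne 𝕜 X) (A : Set Γ) (x : X Γ) :
    ‖proj 𝕜 A x‖ + ‖proj 𝕜 Aᶜ x‖ ≤ ‖x‖ := by
  classical
  rw [← le_sub_iff_add_le]
  refine norm_le_of_sum_norm_coord_le (𝕜 := 𝕜) _ fun F => ?_
  rw [le_sub_comm]
  refine norm_le_of_sum_norm_coord_le (𝕜 := 𝕜) _ fun G => ?_
  rw [le_sub_iff_add_le]
  refine le_trans ?_ (hX Γ x (F ∪ G))
  calc _ ≤ ∑ i ∈ F ∪ G, ‖coord (𝕜 := 𝕜) (proj 𝕜 Aᶜ x) i‖ +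
        ∑ i ∈ F ∪ G, ‖coord (𝕜 := 𝕜) (proj 𝕜 A x) i‖ := by
        gcongr
        · exact Finset.subset_union_right
        · exact Finset.subset_union_left
    _ = ∑ i ∈ F ∪ G, ‖coord (𝕜 := 𝕜) x i‖ := by
        rw [← Finset.sum_add_distrib]
        refine Finset.sum_congr rfl fun i _ => ?_
        rw [coord_proj, coord_proj]
        by_cases hi : i ∈ A
        · rw [Set.indicator_of_mem hi, Set.indicator_of_notMem (Set.notMem_compl_iff.2 hi),
            norm_zero, zero_add]
        · rw [Set.indicator_of_notMem hi, Set.indicator_of_mem hi, norm_zero, add_zero]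

theorem IsEllOne.opNorm_le {Y : Type*} [NormedAddCommGroup Y] [NormedSpace 𝕜 Y]
    (hX : IsEllOne 𝕜 X) (R : X I →L[𝕜] Y) {C : ℝ} (hC : 0 ≤ C)
    (hR : ∀ i, ‖R (single 𝕜 X i)‖ ≤ C) : ‖R‖ ≤ C := by
  refine R.opNorm_le_bound hC fun x => norm_apply_le_of_finset _ _ _ fun F => ?_
  rw [proj_finset, map_sum]
  calc _ ≤ ∑ i ∈ F, C * ‖coord (𝕜 := 𝕜) x i‖ := norm_sum_le_of_le _ fun i _ => by
        rw [map_smul, norm_smul, mul_comm]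
        gcongr
        exact hR i
    _ = C * ∑ i ∈ F, ‖coord (𝕜 := 𝕜) x i‖ := by rw [Finset.mul_sum]
    _ ≤ C * ‖x‖ := by gcongr; exact hX I x F

/-- The lifting property of `ℓ₁`: the defining series converges absolutely. Unlike
`exists_synthesis`, it asks for no disjointness of the vectors. -/
theorem IsEllOne.exists_lift {Y : Type*} [NormedAddCommGroup Y] [NormedSpace 𝕜 Y] [CompleteSpace Y]
    (hX : IsEllOne 𝕜 X) (y : I → Y) (hy : ∀ i, ‖y i‖ ≤ 1) :
    ∃ W : X I →L[𝕜] Y, ∀ i, W (single 𝕜 X i) = y i := by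
  have hle : ∀ (a : X I) i, ‖coord (𝕜 := 𝕜) a i • y i‖ ≤ ‖coord (𝕜 := 𝕜) a i‖ := fun a i => by
    rw [norm_smul]; exact mul_le_of_le_one_right (norm_nonneg _) (hy i)
  have hs : ∀ a : X I, Summable fun i => ‖coord (𝕜 := 𝕜) a i • y i‖ := fun a =>
    summable_of_sum_le (fun _ => norm_nonneg _) fun F =>
      (Finset.sum_le_sum fun i _ => hle a i).trans (hX I a F)
  refine ⟨LinearMap.mkContinuous
    { toFun := fun a => ∑' i, coord (𝕜 := 𝕜) a i • y i
      map_add' := fun a b => ?_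
      map_smul' := fun c a => ?_ } 1 fun a => ?_, fun i => ?_⟩
  · rw [← (hs a).of_norm.tsum_add (hs b).of_norm]
    simp only [map_add, Pi.add_apply, add_smul]
  · rw [RingHom.id_apply, ← (hs a).of_norm.tsum_const_smul]
    simp only [coord_smul, mul_smul]
  · rw [one_mul]
    refine (norm_tsum_le_tsum_norm (hs a)).trans ((hs a).tsum_le_of_sum_le fun F => ?_)
    exact (Finset.sum_le_sum fun i _ => hle a i).trans (hX I a F)
  · change ∑' j, coord (𝕜 := 𝕜) (single 𝕜 X i) j • y j = y i
    rw [tsum_eq_single i fun j hj => by rw [coord_single_ne hj, zero_smul], coord_single_self,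
      one_smul]

/-- Let `s` be the infimum of the norms of `S` followed by removal of fewer than `#I` coordinates.
After removal of a nearly optimal set `E₀`, a vector nearly norming the remainder beyond the earlier
supports has, by additivity of the norm, little mass left on them. Uniform errors suffice, because
an operator on `ℓ₁` has norm the supremum over the unit vectors. -/
theorem IsEllOne.approxBySmaller_or_idFactorsThrough (hX : IsEllOne 𝕜 X)
    [∀ Γ, CompleteSpace (X Γ)] (hI : ℵ₀ ≤ #I) (S : X Γ →L[𝕜] X Λ) :
    ApproxBySmaller 𝕜 #I S ∨ IdFactorsThrough 𝕜 I S := by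
  refine or_iff_not_imp_left.2 fun hS => ?_
  have hS' := mt ApproxBySmaller.of_codomain hS
  push Not at hS'
  obtain ⟨ε, hε, hS'⟩ := hS'
  obtain ⟨r, hwo, hr⟩ := Cardinal.exists_ord_eq I
  have hr' : ∀ i, #{j // r j i} < #I := fun i => by
    simpa [Ordinal.card_typein] using Cardinal.card_typein_lt i hr
  set A : Set ℝ := {t | ∃ E : Set Λ, #E < #I ∧ ‖proj 𝕜 Eᶜ ∘L S‖ = t} with hA
  have hAne : A.Nonempty := ⟨_, ∅, by
    rw [Cardinal.mk_eq_zero]; exact Cardinal.aleph0_pos.trans_le hI, rfl⟩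
  have hAbdd : BddBelow A := ⟨0, by rintro _ ⟨E, -, rfl⟩; exact norm_nonneg _⟩
  set s := sInf A with hs
  have hs0 : 0 < s := hε.trans_le (le_csInf hAne (by rintro _ ⟨E, hE, rfl⟩; exact (hS' E hE).le))
  obtain ⟨_, ⟨E₀, hE₀, rfl⟩, hE₀s⟩ := exists_lt_of_csInf_lt hAne (by linarith : sInf A < 1.05 * s)
  obtain ⟨f, hf⟩ := exists_forall_of_wellFounded (C := X Γ × Finset Λ)
    (r := r) IsWellFounded.wf
    (fun i t c => ‖c.1‖ ≤ 1 ∧ 0.95 * s ≤ ‖proj 𝕜 (E₀ ∪ ⋃ j, ((t j).2 : Set Λ))ᶜ (S c.1)‖ ∧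
      ‖proj 𝕜 (c.2 : Set Λ)ᶜ (S c.1)‖ ≤ 0.05 * s) fun i t => by
    have h1 : s ≤ ‖proj 𝕜 (E₀ ∪ ⋃ j, ((t j).2 : Set Λ))ᶜ ∘L S‖ := csInf_le hAbdd
      ⟨_, Cardinal.mk_union_lt_of_lt hI hE₀
        (Cardinal.mk_iUnion_lt_of_finite hI (hr' i) _ fun j => (t j).2.finite_toSet), rfl⟩
    obtain ⟨x, hx, hx'⟩ := ContinuousLinearMap.exists_lt_apply_of_lt_opNorm _
      ((by linarith : 0.95 * s < s).trans_le h1)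
    obtain ⟨F, hF⟩ := exists_finset_norm_proj_compl_le (𝕜 := 𝕜) (S x)
      (by positivity : 0 < 0.05 * s)
    exact ⟨(x, F), hx.le, hx'.le, hF⟩
  choose hf1 hf2 hf3 using hf
  obtain ⟨W, hW⟩ := hX.exists_lift (𝕜 := 𝕜) (fun i => (f i).1) hf1
  let F : I → Set Λ := fun i => (f i).2
  let S' : X Γ →L[𝕜] X Λ := proj 𝕜 E₀ᶜ ∘L S
  -- The earlier supports carry at most `1.05 * s - 0.95 * s`, and the tail off `F i` at most `0.05
  -- * s`. This leaves at least `0.95 * s - 0.15 * s = 0.8 * s` on the block.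
  have hcompl : ∀ i, ‖proj 𝕜 (F i \ ⋃ k : {k // r k i}, F k)ᶜ (S' (W (single 𝕜 X i)))‖ ≤
      0.15 * s := fun i => by
    have h : (F i \ ⋃ k : {k // r k i}, F k)ᶜ = (⋃ k : {k // r k i}, F k) ∪ (F i)ᶜ := by
      rw [Set.sdiff_eq, Set.compl_inter, compl_compl, Set.union_comm]
    rw [h, hW]
    refine (norm_proj_union_le _ _ _).trans ?_
    have h1 := hX.norm_proj_add_norm_proj_compl_le (⋃ k : {k // r k i}, F k) (S' (f i).1)
    have h2 : ‖S' (f i).1‖ ≤ 1.05 * s :=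
      (S'.le_of_opNorm_le hE₀s.le _).trans (mul_le_of_le_one_right (by positivity) (hf1 i))
    have h3 : 0.95 * s ≤ ‖proj 𝕜 (⋃ k : {k // r k i}, F k)ᶜ (S' (f i).1)‖ := by
      have := hf2 i
      rwa [Set.compl_union, Set.inter_comm, ← proj_proj] at this
    have h4 : ‖proj 𝕜 (F i)ᶜ (S' (f i).1)‖ ≤ 0.05 * s := by
      refine le_trans ?_ (hf3 i)
      change ‖proj 𝕜 (F i)ᶜ (proj 𝕜 E₀ᶜ (S (f i).1))‖ ≤ _
      rw [proj_proj]
      exact norm_proj_mono Set.inter_subset_left _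
    linarith
  obtain ⟨V, hV⟩ := exists_left_inverse_of_blocks S' W (fun i => F i \ ⋃ k : {k // r k i}, F k)
    (pairwise_disjoint_diff_iUnion r F) (by positivity : 0 < 0.8 * s) (fun i => by
      have h3 := norm_add_le (proj 𝕜 (F i \ ⋃ k : {k // r k i}, F k) (S' (W (single 𝕜 X i))))
        (proj 𝕜 (F i \ ⋃ k : {k // r k i}, F k)ᶜ (S' (W (single 𝕜 X i))))
      rw [proj_add_proj_compl] at h3
      have h4 := hcompl i
      have h5 : 0.95 * s ≤ ‖S' (W (single 𝕜 X i))‖ := by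
        refine (hf2 i).trans ?_
        rw [hW]
        exact norm_proj_mono (Set.compl_subset_compl.2 Set.subset_union_left) _
      linarith) (fun _ => 0.15 * s) hcompl
    fun R hR => by
      refine (hX.opNorm_le R (C := 0.15 * s / (0.8 * s)) (by positivity) hR).trans_lt ?_
      rw [div_lt_one (by positivity)]
      linarith
  exact ⟨W, V ∘L proj 𝕜 E₀ᶜ, hV⟩

end SequenceSpace

/-! ### Factorisation and the classification of closed ideals -/

namespace SequenceSpace

variable {𝕜 : Type w} [RCLike 𝕜] {X : Type u → Type v}
  [∀ Γ, NormedAddCommGroup (X Γ)] [∀ Γ, NormedSpace 𝕜 (X Γ)]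
  {Γ Λ I K : Type u}

/-- On the range of `W` the map `V ∘L T` inverts `W`, so this range is the required copy. -/
theorem IdFactorsThrough.boundedBelowOnCopy {T : X Γ →L[𝕜] X Λ} (h : IdFactorsThrough 𝕜 I T) :
    BoundedBelowOnCopy (X I) T := by
  obtain ⟨W, V, hVW⟩ := h
  have hVW' : ∀ x, V (T (W x)) = x := fun x => DFunLike.congr_fun hVW x
  refine ⟨LinearMap.range (W : X I →ₗ[𝕜] X Γ), ⟨ContinuousLinearEquiv.equivOfInverse
    ((V ∘L T) ∘L Submodule.subtypeL _) (W.codRestrict _ fun x => ⟨x, rfl⟩) ?_ hVW'⟩,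
    (‖W‖ * ‖V‖ + 1)⁻¹, by positivity, ?_⟩
  · rintro ⟨_, x, rfl⟩
    refine Subtype.ext ?_
    change W (V (T (W x))) = W x
    rw [hVW']
  · rintro _ ⟨x, rfl⟩
    change _ * ‖W x‖ ≤ ‖T (W x)‖
    rw [inv_mul_le_iff₀ (by positivity)]
    calc ‖W x‖ ≤ ‖W‖ * ‖V (T (W x))‖ := by rw [hVW']; exact W.le_opNorm x
      _ ≤ ‖W‖ * (‖V‖ * ‖T (W x)‖) := by gcongr; exact V.le_opNorm _
      _ ≤ (‖W‖ * ‖V‖ + 1) * ‖T (W x)‖ := by nlinarith [norm_nonneg (T (W x))]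

variable [SequenceSpace 𝕜 X]

theorem approxBySmaller_or_idFactorsThrough (hX : Shrinking 𝕜 X ∨ IsEllOne 𝕜 X)
    [∀ Γ, CompleteSpace (X Γ)] (hI : ℵ₀ ≤ #I) (S : X Γ →L[𝕜] X Λ) :
    ApproxBySmaller 𝕜 #I S ∨ IdFactorsThrough 𝕜 I S :=
  hX.elim (fun h => h.approxBySmaller_or_idFactorsThrough hI S)
    fun h => h.approxBySmaller_or_idFactorsThrough hI S

/-- The copy need not be complemented: the dichotomy is applied to `T` composed with the embedding,
and `mk_le_of_norm_sub_comp_le` rules out its first alternative. -/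
theorem idFactorsThrough_of_boundedBelowOnCopy (hX : Shrinking 𝕜 X ∨ IsEllOne 𝕜 X)
    [∀ Γ, CompleteSpace (X Γ)] (hI : ℵ₀ ≤ #I) {T : X Γ →L[𝕜] X Λ}
    (h : BoundedBelowOnCopy (X I) T) : IdFactorsThrough 𝕜 I T := by
  obtain ⟨E, ⟨e⟩, c, hc, hT⟩ := h
  let U : X I →L[𝕜] X Γ := E.subtypeL ∘L (e.symm : X I →L[𝕜] E)
  have hU : ∀ x, c / (‖(e : E →L[𝕜] X I)‖ + 1) * ‖x‖ ≤ ‖(T ∘L U) x‖ := fun x => by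
    have h1 : ‖x‖ ≤ (‖(e : E →L[𝕜] X I)‖ + 1) * ‖e.symm x‖ := by
      have := (e : E →L[𝕜] X I).le_opNorm (e.symm x)
      rw [ContinuousLinearEquiv.coe_coe, e.apply_symm_apply] at this
      nlinarith [norm_nonneg (e.symm x)]
    refine le_trans ?_ (hT _ (e.symm x).2)
    rw [div_mul_eq_mul_div, div_le_iff₀ (by positivity), mul_assoc]
    gcongr
    rw [mul_comm]
    exact h1
  have hc' : 0 < c / (‖(e : E →L[𝕜] X I)‖ + 1) := by positivity
  rcases approxBySmaller_or_idFactorsThrough hX hI (T ∘L U) with h | ⟨W, V, h⟩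
  · obtain ⟨K, B, A, hK, hBA⟩ := h _ (by positivity : 0 < c / (‖(e : E →L[𝕜] X I)‖ + 1) / 4)
    exact absurd hK (mk_le_of_norm_sub_comp_le hI hc' hU B A hBA).not_gt
  · exact ⟨U ∘L W, V, h⟩

/-- A non-zero ideal contains the rank-one operators. -/
theorem smulRight_mem {Y : Type*} [NormedAddCommGroup Y] [NormedSpace 𝕜 Y]
    {J : TwoSidedIdeal (Y →L[𝕜] Y)} (hJ : J ≠ ⊥) (φ : Y →L[𝕜] 𝕜) (y : Y) :
    φ.smulRight y ∈ J := by
  obtain ⟨T, hT, hT0⟩ : ∃ T ∈ J, T ≠ 0 := by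
    by_contra hcon
    push Not at hcon
    exact hJ (le_bot_iff.1 fun T hT => (TwoSidedIdeal.mem_bot _).2 (hcon T hT))
  obtain ⟨x, hx⟩ : ∃ x, T x ≠ 0 := by
    by_contra hcon
    push Not at hcon
    exact hT0 (ContinuousLinearMap.ext hcon)
  obtain ⟨ψ, -, hψ⟩ := exists_dual_vector 𝕜 (T x) (norm_ne_zero_iff.2 hx)
  have hne : (‖T x‖ : 𝕜) ≠ 0 := by simpa using hx
  have : φ.smulRight y = ψ.smulRight ((‖T x‖ : 𝕜)⁻¹ • y) * T * φ.smulRight x := by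
    ext z
    change φ z • y = ψ (T (φ z • x)) • ((‖T x‖ : 𝕜)⁻¹ • y)
    rw [map_smul, map_smul, hψ, smul_smul, smul_eq_mul, mul_assoc, mul_inv_cancel₀ hne, mul_one]
  rw [this]
  exact J.mul_mem_right _ _ (J.mul_mem_left _ _ hT)

/-- Operators that factor through `X K` belong to a non-zero ideal if `K` is finite. -/
theorem comp_mem_of_finite [Finite K] {J : TwoSidedIdeal (X Λ →L[𝕜] X Λ)} (hJ : J ≠ ⊥)
    (A : X K →L[𝕜] X Λ) (B : X Λ →L[𝕜] X K) : A ∘L B ∈ J := by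
  have := Fintype.ofFinite K
  have : A ∘L B = ∑ k : K, (coordCLM 𝕜 k ∘L B).smulRight (A (single 𝕜 X k)) := by
    ext x
    have h := proj_finset (𝕜 := 𝕜) Finset.univ (B x)
    rw [proj_eq_self fun γ hγ => absurd (Finset.mem_coe.2 (Finset.mem_univ γ)) hγ] at h
    rw [ContinuousLinearMap.comp_apply, h, map_sum, sum_apply]
    exact Finset.sum_congr rfl fun k _ => map_smul _ _ _
  rw [this]
  exact sum_mem fun k _ => smulRight_mem hJ _ _

/-- Every non-zero, proper, closed two-sided ideal consists of the `X κ`-singular operators for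
some infinite cardinal `κ`. -/
theorem exists_eq_singularOperators (hX : Shrinking 𝕜 X ∨ IsEllOne 𝕜 X)
    [∀ Γ, CompleteSpace (X Γ)] (lam : Cardinal.{u}) (hlam : ℵ₀ ≤ lam)
    (J : TwoSidedIdeal (X lam.out →L[𝕜] X lam.out))
    (hJc : IsClosed (J : Set (X lam.out →L[𝕜] X lam.out))) (hJb : J ≠ ⊥) (hJt : J ≠ ⊤) :
    ∃ κ : Cardinal.{u}, ℵ₀ ≤ κ ∧ κ ≤ lam ∧ (J : Set (X lam.out →L[𝕜] X lam.out)) =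
      singularOperators 𝕜 (X κ.out) (X lam.out) (X lam.out) := by
  let A : Set Cardinal.{u} := {κ | ℵ₀ ≤ κ ∧ ∀ (U : X κ.out →L[𝕜] X lam.out)
    (V : X lam.out →L[𝕜] X κ.out), V ∘L U = ContinuousLinearMap.id 𝕜 _ → U ∘L V ∉ J}
  have hlamA : lam ∈ A := by
    refine ⟨hlam, fun U V hVU hUV => hJt (J.eq_top ?_)⟩
    have : (1 : X lam.out →L[𝕜] X lam.out) = V * (U ∘L V) * U := by
      change _ = (V ∘L (U ∘L V)) ∘L U
      rw [← ContinuousLinearMap.comp_assoc, hVU, ContinuousLinearMap.id_comp, hVU]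
      rfl
    rw [this]
    exact J.mul_mem_right _ _ (J.mul_mem_left _ _ hUV)
  obtain ⟨κ, hκA, hκmin⟩ := WellFounded.has_min (wellFounded_lt (α := Cardinal.{u})) A ⟨lam, hlamA⟩
  have hκ : ℵ₀ ≤ #κ.out := by rw [Cardinal.mk_out]; exact hκA.1
  refine ⟨κ, hκA.1, not_lt.1 (hκmin lam hlamA), Set.Subset.antisymm (fun T hT hcopy => ?_)
    fun T hT => ?_⟩
  · obtain ⟨W, V, h⟩ := idFactorsThrough_of_boundedBelowOnCopy hX hκ hcopy
    exact hκA.2 (T ∘L W) V h (J.mul_mem_right T (W ∘L V) hT)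
  · have happ : ApproxBySmaller 𝕜 #κ.out T :=
      (approxBySmaller_or_idFactorsThrough hX hκ T).resolve_right fun h =>
        hT h.boundedBelowOnCopy
    rw [← hJc.closure_eq, Metric.mem_closure_iff]
    intro ε hε
    obtain ⟨K, B, C, hK, hBC⟩ := happ (ε / 2) (half_pos hε)
    refine ⟨C ∘L B, ?_, by rw [dist_eq_norm]; linarith⟩
    rcases finite_or_infinite K with hfin | hinf
    · exact comp_mem_of_finite hJb C B
    · rw [Cardinal.mk_out] at hK
      have hnot : #K ∉ A := fun h => hκmin _ h hK
      simp only [A, Set.mem_ofPred_eq, not_and, not_forall, not_not] at hnot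
      obtain ⟨U, V, hVU, hUV⟩ := hnot (Cardinal.aleph0_le_mk K)
      -- Minimality of `κ` speaks of the chosen representative of `#K`; a bijection transports it to
      -- `K`.
      obtain ⟨U', V', hVU', -⟩ := exists_factor_of_injective (𝕜 := 𝕜) (X := X)
        (Cardinal.outMkEquiv (α := K)).symm.injective
      have : C ∘L B = (C ∘L V' ∘L V) * (U ∘L V) * (U ∘L U' ∘L B) := by
        ext x
        have h1 : ∀ x, V (U x) = x := fun x => DFunLike.congr_fun hVU x
        have h2 : ∀ x, V' (U' x) = x := fun x => DFunLike.congr_fun hVU' x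
        change C (B x) = C (V' (V (U (V (U (U' (B x)))))))
        rw [h1, h1, h2]
      rw [this]
      exact J.mul_mem_right _ _ (J.mul_mem_left _ _ hUV)

end SequenceSpace

/-! ### The two models: `ℓ_p` and `c₀` -/

/-- Functions with disjoint supports can be glued together with prescribed coefficients. -/
theorem exists_glue_of_disjoint {𝕜 Γ I : Type*} [MulZeroClass 𝕜] (x : I → Γ → 𝕜)
    (hx : ∀ i j γ, x i γ ≠ 0 → x j γ ≠ 0 → i = j) (a : I → 𝕜) :
    ∃ z : Γ → 𝕜, (∀ i γ, x i γ ≠ 0 → z γ = a i * x i γ) ∧ ∀ γ, (∀ i, x i γ = 0) → z γ = 0 := by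
  classical
  refine ⟨fun γ => if h : ∃ i, x i γ ≠ 0 then a h.choose * x h.choose γ else 0,
    fun i γ hi => ?_, fun γ h => ?_⟩
  · have h : ∃ i, x i γ ≠ 0 := ⟨i, hi⟩
    simp only [dif_pos h, hx _ i γ h.choose_spec hi]
  · exact dif_neg (by simpa using h)

namespace SequenceSpace

theorem coord_sum_single (𝕜 : Type w) [RCLike 𝕜] {X : Type u → Type v}
    [∀ Γ, NormedAddCommGroup (X Γ)] [∀ Γ, NormedSpace 𝕜 (X Γ)] [SequenceSpace 𝕜 X] {Γ : Type u}
    (F : Finset Γ) :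
    coord (𝕜 := 𝕜) (∑ i ∈ F, single 𝕜 X i) = Set.indicator (F : Set Γ) fun _ => (1 : 𝕜) := by
  classical
  ext γ
  rw [coord_sum]
  simp only [coord_single, Set.indicator_apply, Finset.mem_coe, Set.mem_singleton_iff,
    Finset.sum_ite_eq]

section Lp

variable {𝕜 : Type w} [RCLike 𝕜] {p : ℝ≥0∞} {Γ : Type u}

theorem exists_lp_of_sum_le (hp : 0 < p.toReal) (f : Γ → 𝕜) {C : ℝ} (hC : 0 ≤ C)
    (h : ∀ s : Finset Γ, ∑ i ∈ s, ‖f i‖ ^ p.toReal ≤ C ^ p.toReal) :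
    ∃ y : lp (fun _ : Γ => 𝕜) p, ⇑y = f ∧ ‖y‖ ≤ C :=
  ⟨⟨f, memℓp_gen' h⟩, rfl, lp.norm_le_of_forall_sum_le hp hC h⟩

/-- The spaces `ℓ_p(Γ)`, for `p < ∞`, form a family of sequence spaces. -/
noncomputable abbrev lpSequenceSpace (𝕜 : Type w) [RCLike 𝕜] (p : ℝ≥0∞) [Fact (1 ≤ p)]
    (hp : p ≠ ∞) : SequenceSpace 𝕜 (fun Γ : Type u => lp (fun _ : Γ => 𝕜) p) :=
  have hp0 : 0 < p.toReal :=
    ENNReal.toReal_pos (zero_lt_one.trans_le Fact.out).ne' hp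
  { coord := fun {Γ} =>
      { toFun := fun x => ⇑x
        map_add' := lp.coeFn_add
        map_smul' := lp.coeFn_smul }
    coord_injective := fun {Γ} x y h => lp.ext h
    norm_coord_le := fun {Γ} x i => lp.norm_apply_le_norm (zero_lt_one.trans_le Fact.out).ne' x i
    exists_single := fun {Γ} i => by
      classical
      refine exists_lp_of_sum_le hp0 _ zero_le_one fun s => ?_
      calc _ ≤ ∑ j ∈ s, if i = j then (1 : ℝ) else 0 := Finset.sum_le_sum fun j _ => by
            by_cases h : i = j
            · subst h; simp
            · simp [h, Ne.symm h, hp0.ne']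
        _ ≤ 1 ^ p.toReal := by
            rw [Finset.sum_ite_eq, Real.one_rpow]
            split_ifs <;> norm_num
    solid := fun {Γ} x f hf => exists_lp_of_sum_le hp0 f (norm_nonneg x) fun s =>
      (Finset.sum_le_sum fun i _ => Real.rpow_le_rpow (norm_nonneg _) (hf i) hp0.le).trans
        (lp.sum_rpow_le_norm_rpow hp0 x s)
    approx := fun {Γ} x ε hε => by
      classical
      -- A partial sum within `ε ^ p` of the full sum leaves a tail of norm at most `ε`.
      obtain ⟨F, hF⟩ := ((lp.hasSum_norm hp0 x).eventually
        (lt_mem_nhds (sub_lt_self _ (Real.rpow_pos_of_pos hε p.toReal)))).exists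
      refine ⟨F, fun y hy => lp.norm_le_of_forall_sum_le hp0 hε.le fun s => ?_⟩
      have hy' : ∀ i, y i = Set.indicator (F : Set Γ)ᶜ x i := fun i => congrFun hy i
      have h1 : ∑ i ∈ s, ‖y i‖ ^ p.toReal ≤ ∑ i ∈ s \ F, ‖x i‖ ^ p.toReal := by
        rw [Finset.sdiff_eq_filter, Finset.sum_filter]
        refine Finset.sum_le_sum fun i _ => ?_
        by_cases h : i ∈ F <;> simp [hy', h, hp0.ne']
      have h2 := lp.sum_rpow_le_norm_rpow hp0 x (F ∪ s \ F)
      rw [Finset.sum_union Finset.disjoint_sdiff] at h2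
      linarith
    analysis := fun {Γ I} B hB x y f hy hf => by
      refine exists_lp_of_sum_le hp0 f (norm_nonneg x) fun G => ?_
      have hy' : ∀ i γ, y i γ = (B i).indicator x γ := fun i γ => congrFun (hy i) γ
      calc ∑ i ∈ G, ‖f i‖ ^ p.toReal ≤ ∑ i ∈ G, ‖y i‖ ^ p.toReal :=
            Finset.sum_le_sum fun i _ => Real.rpow_le_rpow (norm_nonneg _) (hf i) hp0.le
        _ ≤ ‖x‖ ^ p.toReal := by
            refine hasSum_le (fun γ => ?_) (hasSum_sum fun i _ => lp.hasSum_norm hp0 (y i))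
              (lp.hasSum_norm hp0 x)
            by_cases h : ∃ i ∈ G, γ ∈ B i
            · obtain ⟨i, hi, hγ⟩ := h
              rw [Finset.sum_eq_single_of_mem i hi fun j _ hji => by
                rw [hy', Set.indicator_of_notMem (Set.disjoint_right.1 (hB hji) hγ), norm_zero,
                  Real.zero_rpow hp0.ne'], hy', Set.indicator_of_mem hγ]
            · push Not at h
              rw [Finset.sum_eq_zero fun i hi => by
                rw [hy', Set.indicator_of_notMem (h i hi), norm_zero, Real.zero_rpow hp0.ne']]
              positivity
    synthesis := fun {Γ I} x hx hx1 a => by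
      obtain ⟨z, hz1, hz2⟩ := exists_glue_of_disjoint (fun i => ⇑(x i)) hx a
      obtain ⟨y, rfl, hy⟩ := exists_lp_of_sum_le hp0 z (norm_nonneg a) fun s => by
        -- By disjointness each point of `s` meets at most one `x i`, so the double sum below is
        -- finite and can be exchanged.
        have hG : (⋃ γ ∈ s, {i | x i γ ≠ 0}).Finite := s.finite_toSet.biUnion fun γ _ =>
          Set.Subsingleton.finite fun i hi j hj => hx i j γ hi hj
        calc ∑ γ ∈ s, ‖z γ‖ ^ p.toReal
            ≤ ∑ γ ∈ s, ∑ i ∈ hG.toFinset, ‖a i‖ ^ p.toReal * ‖x i γ‖ ^ p.toReal :=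
              Finset.sum_le_sum fun γ hγ => by
                by_cases h : ∀ i, x i γ = 0
                · rw [hz2 γ h, norm_zero, Real.zero_rpow hp0.ne']
                  positivity
                · push Not at h
                  obtain ⟨i, hi⟩ := h
                  rw [hz1 i γ hi, norm_mul, Real.mul_rpow (norm_nonneg _) (norm_nonneg _)]
                  refine Finset.single_le_sum
                    (f := fun i => ‖a i‖ ^ p.toReal * ‖x i γ‖ ^ p.toReal)
                    (fun _ _ => by positivity) ?_
                  rw [Set.Finite.mem_toFinset]
                  exact Set.mem_biUnion hγ hi
          _ = ∑ i ∈ hG.toFinset, ‖a i‖ ^ p.toReal * ∑ γ ∈ s, ‖x i γ‖ ^ p.toReal := by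
              rw [Finset.sum_comm]
              simp only [Finset.mul_sum]
          _ ≤ ∑ i ∈ hG.toFinset, ‖a i‖ ^ p.toReal := Finset.sum_le_sum fun i _ => by
              refine mul_le_of_le_one_right (by positivity) ?_
              exact (lp.sum_rpow_le_norm_rpow hp0 (x i) s).trans
                (Real.rpow_le_one (norm_nonneg _) (hx1 i) hp0.le)
          _ ≤ ‖a‖ ^ p.toReal := lp.sum_rpow_le_norm_rpow hp0 a _
      exact ⟨y, hz1, hz2, hy⟩ }

theorem shrinking_or_isEllOne_lp (𝕜 : Type w) [RCLike 𝕜] (p : ℝ≥0∞) [Fact (1 ≤ p)] (hp : p ≠ ∞) :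
    letI := lpSequenceSpace.{u} 𝕜 p hp
    Shrinking 𝕜 (fun Γ : Type u => lp (fun _ : Γ => 𝕜) p) ∨
      IsEllOne 𝕜 (fun Γ : Type u => lp (fun _ : Γ => 𝕜) p) := by
  let _ := lpSequenceSpace.{u} 𝕜 p hp
  have hp1 : 1 ≤ p := Fact.out
  have hp0 : 0 < p.toReal := ENNReal.toReal_pos (zero_lt_one.trans_le hp1).ne' hp
  rcases hp1.eq_or_lt with rfl | hp1
  · right
    intro Γ x F
    have := lp.sum_rpow_le_norm_rpow hp0 x F
    simp only [ENNReal.toReal_one, Real.rpow_one] at this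
    exact this
  · left
    intro ε hε
    have hp1' : 1 < p.toReal := by
      rw [← ENNReal.toReal_one]
      exact (ENNReal.toReal_lt_toReal ENNReal.one_ne_top hp).2 hp1
    -- A sum of `N` unit vectors has norm at most `N ^ (1 / p)`, and `N ^ (1 / p) / N` tends to zero
    -- because `p > 1`.
    have hlim := (tendsto_rpow_neg_atTop (sub_pos.2 (inv_lt_one_of_one_lt₀ hp1'))).comp
      (tendsto_natCast_atTop_atTop (R := ℝ))
    obtain ⟨N, hN, hN0⟩ := ((hlim.eventually (gt_mem_nhds hε)).and
      (Filter.eventually_gt_atTop 0)).exists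
    have hN0' : (0 : ℝ) < N := by exact_mod_cast hN0
    refine ⟨N, hN0, fun Γ F hF => ?_⟩
    classical
    obtain ⟨y, hy, hyN⟩ := exists_lp_of_sum_le hp0 (Set.indicator (F : Set Γ) fun _ => (1 : 𝕜))
      (C := (N : ℝ) ^ (p.toReal)⁻¹) (by positivity) fun s => by
        rw [Real.rpow_inv_rpow hN0'.le hp0.ne']
        calc _ = ∑ i ∈ s, if i ∈ F then (1 : ℝ) else 0 := Finset.sum_congr rfl fun i _ => by
              by_cases h : i ∈ F <;> simp [h, hp0.ne']
          _ ≤ N := by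
              rw [Finset.sum_ite_mem, Finset.sum_const, nsmul_eq_mul, mul_one, ← hF]
              exact_mod_cast Finset.card_le_card Finset.inter_subset_right
    have hyF : ∑ i ∈ F, single 𝕜 (fun Γ : Type u => lp (fun _ : Γ => 𝕜) p) i = y :=
      coord_injective (𝕜 := 𝕜) (X := fun Γ : Type u => lp (fun _ : Γ => 𝕜) p)
        ((coord_sum_single 𝕜 F).trans hy.symm)
    rw [hyF]
    refine hyN.trans ?_
    have h : (N : ℝ) ^ (p.toReal)⁻¹ = (N : ℝ) ^ (-(1 - (p.toReal)⁻¹)) * N := by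
      rw [← Real.rpow_add_one hN0'.ne']
      congr 1
      ring
    rw [h]
    gcongr
    exact hN.le

end Lp

section C0

variable {𝕜 : Type w} [RCLike 𝕜] {Γ : Type u}

variable (𝕜 Γ) in
/-- The coordinates of a vector of `c₀(Γ)`. -/
def c0Coord : C₀(DiscreteSpace Γ, 𝕜) →ₗ[𝕜] (Γ → 𝕜) where
  toFun := fun x => ⇑x
  map_add' := fun _ _ => rfl
  map_smul' := fun _ _ => rfl

theorem finite_setOf_le_norm (x : C₀(DiscreteSpace Γ, 𝕜)) {ε : ℝ} (hε : 0 < ε) :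
    {i | ε ≤ ‖c0Coord 𝕜 Γ x i‖}.Finite := by
  have h := (x.zero_at_infty'.norm).eventually (gt_mem_nhds (by simpa using hε : ‖(0 : 𝕜)‖ < ε))
  rw [Filter.cocompact_eq_cofinite, Filter.eventually_cofinite] at h
  simp only [not_lt] at h
  exact h

theorem norm_c0_le (x : C₀(DiscreteSpace Γ, 𝕜)) {C : ℝ} (hC : 0 ≤ C) :
    ‖x‖ ≤ C ↔ ∀ i, ‖c0Coord 𝕜 Γ x i‖ ≤ C := by
  rw [← ZeroAtInftyContinuousMap.norm_toBCF_eq_norm]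
  exact BoundedContinuousFunction.norm_le hC

theorem exists_c0_of_finite (f : Γ → 𝕜) {C : ℝ} (hC : 0 ≤ C) (h : ∀ i, ‖f i‖ ≤ C)
    (hfin : ∀ ε : ℝ, 0 < ε → {i | ε ≤ ‖f i‖}.Finite) :
    ∃ y : C₀(DiscreteSpace Γ, 𝕜), c0Coord 𝕜 Γ y = f ∧ ‖y‖ ≤ C := by
  have hlim : Filter.Tendsto f Filter.cofinite (nhds 0) := by
    rw [tendsto_zero_iff_norm_tendsto_zero]
    refine tendsto_order.2 ⟨fun a ha => Filter.Eventually.of_forall fun i =>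
      ha.trans_le (norm_nonneg _), fun a ha => ?_⟩
    rw [Filter.eventually_cofinite]
    simpa only [not_lt] using hfin a ha
  let y : C₀(DiscreteSpace Γ, 𝕜) :=
    { toFun := f
      continuous_toFun := continuous_of_discreteTopology
      zero_at_infty' := by
        rw [Filter.cocompact_eq_cofinite]
        exact hlim }
  exact ⟨y, rfl, (norm_c0_le y hC).2 h⟩

/-- The spaces `c₀(Γ)` form a family of sequence spaces. -/
noncomputable abbrev c0SequenceSpace (𝕜 : Type w) [RCLike 𝕜] :
    SequenceSpace 𝕜 (fun Γ : Type u => C₀(DiscreteSpace Γ, 𝕜)) where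
  coord := fun {Γ} => c0Coord 𝕜 Γ
  coord_injective := fun {Γ} x y h => DFunLike.coe_injective h
  norm_coord_le := fun {Γ} x => (norm_c0_le x (norm_nonneg x)).1 le_rfl
  exists_single := fun {Γ} i => by
    classical
    refine exists_c0_of_finite _ zero_le_one (fun j => ?_) fun ε hε => ?_
    · exact (norm_indicator_le_norm_self _ _).trans (by simp)
    · refine (Set.finite_singleton i).subset fun j hj => ?_
      by_contra h
      rw [Set.mem_ofPred_eq, Set.indicator_of_notMem h, norm_zero] at hj
      exact hε.not_ge hj
  solid := fun {Γ} x f hf => exists_c0_of_finite f (norm_nonneg x)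
    (fun i => (hf i).trans ((norm_c0_le x (norm_nonneg x)).1 le_rfl i))
    fun ε hε => (finite_setOf_le_norm x hε).subset fun i hi => le_trans hi (hf i)
  approx := fun {Γ} x ε hε => by
    refine ⟨(finite_setOf_le_norm x hε).toFinset, fun y hy => (norm_c0_le y hε.le).2 fun i => ?_⟩
    rw [hy]
    by_cases h : ε ≤ ‖c0Coord 𝕜 Γ x i‖
    · rw [Set.indicator_of_notMem (by simpa using h), norm_zero]
      exact hε.le
    · rw [Set.indicator_of_mem (by simpa using h)]
      exact (not_le.1 h).le
  analysis := fun {Γ I} B hB x y f hy hf => by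
    have hx := (norm_c0_le x (norm_nonneg x)).1 le_rfl
    refine exists_c0_of_finite f (norm_nonneg x) (fun i => (hf i).trans
      ((norm_c0_le _ (norm_nonneg x)).2 fun γ => ?_)) fun ε hε => ?_
    · rw [hy]
      exact (norm_indicator_le_norm_self _ _).trans (hx γ)
    -- If `‖f i‖ ≥ ε`, the block `B i` contains one of the finitely many points where `x` is at
    -- least `ε / 2` in modulus, and each such point lies in at most one block.
    · refine ((finite_setOf_le_norm x (half_pos hε)).biUnion
        (t := fun γ => {i | γ ∈ B i}) fun γ _ => Set.Subsingleton.finite fun i hi j hj => ?_).subset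
          fun i hi => ?_
      · by_contra hij
        exact Set.disjoint_left.1 (hB hij) hi hj
      · by_contra hcon
        simp only [Set.mem_iUnion, not_exists] at hcon
        have : ‖y i‖ ≤ ε / 2 := (norm_c0_le _ (half_pos hε).le).2 fun γ => by
          rw [hy]
          by_cases hγ : γ ∈ B i
          · rw [Set.indicator_of_mem hγ]
            exact (not_le.1 fun h => hcon γ h hγ).le
          · rw [Set.indicator_of_notMem hγ, norm_zero]
            exact (half_pos hε).le
        have h1 : ε ≤ ‖f i‖ := hi
        linarith [hf i]
  synthesis := fun {Γ I} x hx hx1 a => by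
    obtain ⟨z, hz1, hz2⟩ := exists_glue_of_disjoint (fun i => c0Coord 𝕜 Γ (x i)) hx (c0Coord 𝕜 I a)
    have ha := (norm_c0_le a (norm_nonneg a)).1 le_rfl
    have hx1' : ∀ i γ, ‖c0Coord 𝕜 Γ (x i) γ‖ ≤ 1 := fun i => (norm_c0_le _ zero_le_one).1 (hx1 i)
    obtain ⟨y, rfl, hy⟩ := exists_c0_of_finite z (norm_nonneg a) (fun γ => by
      by_cases h : ∀ i, c0Coord 𝕜 Γ (x i) γ = 0
      · rw [hz2 γ h, norm_zero]
        exact norm_nonneg a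
      · push Not at h
        obtain ⟨i, hi⟩ := h
        rw [hz1 i γ hi, norm_mul]
        exact (mul_le_of_le_one_right (norm_nonneg _) (hx1' i γ)).trans (ha i)) fun ε hε => by
      -- Where the product of `a i` and `x i γ` has modulus at least `ε`, the first factor is at
      -- least `ε` since `‖x i‖ ≤ 1`, and the second at least `ε / (‖a‖ + 1)`; each leaves finitely
      -- many choices.
      refine ((finite_setOf_le_norm a hε).biUnion
        (t := fun i => {γ | ε / (‖a‖ + 1) ≤ ‖c0Coord 𝕜 Γ (x i) γ‖})
        fun i _ => finite_setOf_le_norm (x i) (by positivity)).subset fun γ hγ => ?_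
      have hγ' : ε ≤ ‖z γ‖ := hγ
      by_cases h : ∀ i, c0Coord 𝕜 Γ (x i) γ = 0
      · rw [hz2 γ h, norm_zero] at hγ'
        exact absurd hγ' hε.not_ge
      · push Not at h
        obtain ⟨i, hi⟩ := h
        rw [hz1 i γ hi, norm_mul] at hγ'
        refine Set.mem_biUnion (x := i) ?_ ?_
        · exact hγ'.trans (mul_le_of_le_one_right (norm_nonneg _) (hx1' i γ))
        · rw [Set.mem_ofPred_eq, div_le_iff₀ (by positivity)]
          nlinarith [ha i, norm_nonneg (c0Coord 𝕜 Γ (x i) γ)]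
    exact ⟨y, hz1, hz2, hy⟩

theorem shrinking_c0 (𝕜 : Type w) [RCLike 𝕜] :
    letI := c0SequenceSpace.{u} 𝕜
    Shrinking 𝕜 (fun Γ : Type u => C₀(DiscreteSpace Γ, 𝕜)) := by
  let _ := c0SequenceSpace.{u} 𝕜
  intro ε hε
  obtain ⟨N, hN⟩ := exists_nat_gt (1 / ε)
  have hN0 : (0 : ℝ) < N := (one_div_pos.2 hε).trans hN
  refine ⟨N, by exact_mod_cast hN0, fun Γ F _ => ?_⟩
  rw [div_lt_iff₀' hε] at hN
  refine le_trans ((norm_c0_le _ zero_le_one).2 fun γ => ?_) hN.le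
  have h := congrFun
    (coord_sum_single 𝕜 (X := fun Γ : Type u => C₀(DiscreteSpace Γ, 𝕜)) F) γ
  refine (congrArg norm h).trans_le ((norm_indicator_le_norm_self _ _).trans ?_)
  simp

end C0

end SequenceSpace

theorem theorem1p5 {𝕜 : Type*} [RCLike 𝕜] (lam : Cardinal.{u}) (hlam : ℵ₀ ≤ lam)
    (p : ℝ≥0∞) [Fact (1 ≤ p)] (hp : p ≠ ∞) :
    (∀ J : TwoSidedIdeal (SmallC0 𝕜 lam →L[𝕜] SmallC0 𝕜 lam),
      IsClosed (J : Set (SmallC0 𝕜 lam →L[𝕜] SmallC0 𝕜 lam)) → J ≠ ⊥ → J ≠ ⊤ →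
        ∃ κ : Cardinal.{u}, ℵ₀ ≤ κ ∧ κ ≤ lam ∧
          (J : Set (SmallC0 𝕜 lam →L[𝕜] SmallC0 𝕜 lam)) =
            singularOperators 𝕜 (SmallC0 𝕜 κ) (SmallC0 𝕜 lam) (SmallC0 𝕜 lam)) ∧
    (∀ J : TwoSidedIdeal (SmallLp 𝕜 p lam →L[𝕜] SmallLp 𝕜 p lam),
      IsClosed (J : Set (SmallLp 𝕜 p lam →L[𝕜] SmallLp 𝕜 p lam)) → J ≠ ⊥ → J ≠ ⊤ →
        ∃ κ : Cardinal.{u}, ℵ₀ ≤ κ ∧ κ ≤ lam ∧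
          (J : Set (SmallLp 𝕜 p lam →L[𝕜] SmallLp 𝕜 p lam)) =
            singularOperators 𝕜 (SmallLp 𝕜 p κ) (SmallLp 𝕜 p lam) (SmallLp 𝕜 p lam)) := by
  constructor
  · let _ := SequenceSpace.c0SequenceSpace.{u} 𝕜
    exact SequenceSpace.exists_eq_singularOperators
      (X := fun Γ : Type u => C₀(DiscreteSpace Γ, 𝕜)) (Or.inl (SequenceSpace.shrinking_c0 𝕜))
      lam hlam
  · let _ := SequenceSpace.lpSequenceSpace.{u} 𝕜 p hp
    exact SequenceSpace.exists_eq_singularOperators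
      (X := fun Γ : Type u => lp (fun _ : Γ => 𝕜) p)
      (SequenceSpace.shrinking_or_isEllOne_lp 𝕜 p hp) lam hlam
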